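/- Let $\mathcal{Y}$ be a countable set of outputs and $P_{\mathrm{human}}$ a probability distribution on $\mathcal{Y}$. Let $|D|\ge 1$ and $n\ge 1$. Let $D$ be a training dataset of $|D|$ i.i.d. samples from $P_{\mathrm{human}}$ (repetitions counted), and let the model distribution be its empirical distribution, $$P_{\mathrm{model}}(y)=\frac{1}{|D|}\sum_{y'\in D}\mathbb{I}(y=y').$$ Conditionally on $D$, let $\mathcal{Y}^{n}_{\mathrm{ref}}$ consist of $n$ i.i.d. samples from $P_{\mathrm{model}}$ (repetitions counted), and let $$\widehat{P}(y)=\frac{1}{n}\sum_{y'\in\mathcal{Y}^{n}_{\mathrm{ref}}}\mathbb{I}(y=y').$$ Let $y^*_{\mathrm{MAP}}\in\operatorname{argmax}_{y\in\mathcal{Y}}P_{\mathrm{human}}(y)$ and $\hat{y}_{\mathrm{MAP}}\in\operatorname{argmax}_{y\in\mathcal{Y}^{n}_{\mathrm{ref}}}\widehat{P}(y)$, with ties broken arbitrarily. Then, for every $\delta\in(0,1)$, with probability at least $1-\delta$ (over the draw of both $D$ and $\mathcal{Y}^{n}_{\mathrm{ref}}$), the MAP regret satisfies $$P_{\mathrm{human}}(y^*_{\mathrm{MAP}})-P_{\mathrm{human}}(\hat{y}_{\mathrm{MAP}})\le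 8\sqrt{\frac{1}{n}\log\frac{1}{\delta}}+8\sqrt{\frac{1}{|D|}\log\frac{1}{\delta}}.$$ -/

import Mathlib

open MeasureTheory ProbabilityTheory

/-- The empirical probability of `y` in a finite sample `s = (s 0, …, s (k - 1))`, repetitions
being counted: `(1 / k) * ∑ i, 𝕀(y = s i)`. -/
noncomputable def empiricalProb {Y : Type*} {k : ℕ} (s : Fin k → Y) (y : Y) : ℝ :=
  open scoped Classical in (1 / (k : ℝ)) * ∑ i, if y = s i then (1 : ℝ) else 0

/-- `y` is a maximizer of `f` over the set `A` (one of them, if there are ties). -/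
def IsArgmaxOn {Y : Type*} (f : Y → ℝ) (A : Set Y) (y : Y) : Prop :=
  y ∈ A ∧ ∀ z ∈ A, f z ≤ f y

/-- The two sampling stages, on a countable output space `Y`: the training dataset
`D = (D 0, …, D (m - 1))` consists of `m` i.i.d. samples of the human distribution `Phuman`, the
model distribution is the empirical distribution of `D`, and, conditionally on `D`, the reference
hypotheses `S = (S 0, …, S (n - 1))` are `n` i.i.d. samples of the model distribution. -/
structure IsTwoStageSample {Ω Y : Type*} [MeasurableSpace Ω] [MeasurableSpace Y]
    (μ : Measure Ω) (Phuman : Measure Y) {m n : ℕ}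
    (D : Fin m → Ω → Y) (S : Fin n → Ω → Y) : Prop where
  measurable_dataset : ∀ i, Measurable (D i)
  measurable_refs : ∀ j, Measurable (S j)
  indep_dataset : iIndepFun D μ
  law_dataset : ∀ i, μ.map (D i) = Phuman
  cond_law_refs : ∀ (d : Fin m → Y) (s : Fin n → Y),
    μ.real {ω | (∀ i, D i ω = d i) ∧ ∀ j, S j ω = s j} =
      μ.real {ω | ∀ i, D i ω = d i} * ∏ j, empiricalProb d (s j)

/-- The MAP regret of the output `yhat` with respect to the optimal output `ystar`. -/
noncomputable def mapRegret {Y : Type*} [MeasurableSpace Y] (Phuman : Measure Y)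
    (ystar yhat : Y) : ℝ :=
  Phuman.real {ystar} - Phuman.real {yhat}

/-! Write `L = log (1/δ)`, `r = 1/√n + 1/√m`, `t = 8 √L r`. Let `a` be a mode of the human law, `p`
its probability, and `B` the set of letters less likely than `a` by more than `t`. The regret
exceeds the bound only if a letter of `B` is at least as frequent as `a` among the references, so it
suffices that `a` strictly beats all of `B` with probability at least `1 - exp (-L)`
(`one_sub_exp_le_twoStage_real`). The references can be realised as `D ∘ I`, with `I` uniform
indices independent of `D` (`IsTwoStageSample.map_eq`).

For `L ≥ 1/30` this is concentration. Empirical distributions are means of unit vectors of `ℓ²`, and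
a wrong order of two letters forces an `ℓ²` deviation of at least `t/√2` (`le_meanDev_unitVec`).
McDiarmid's inequality handles `L ≥ 9/10` (`twoStage_real_le_meanDev_le_exp`), second moments handle
the rest (`twoStage_real_le_meanDev_le`).

For `L < 1/30` deviation bounds of this kind are vacuous, but a success probability of `L = t²/(64
r²)` is enough. If `p ≤ t`, then `B` is empty. Otherwise there are two cases.

If `t² ≤ 30 p r²`, part of the excess mass of `a` is set aside. Without it `a` is still a most
likely letter compared with `B`, and an exchange argument shows that it is a most frequent one with
probability at least its own mass (`real_iid_swap`, `real_singleton_le_real_weightedCount_max`). The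
mass set aside then overwrites random positions by `a` and turns ties into strict wins
(`le_real_weightedCount_lt`). This is done conditionally on `I`, where counts in `D ∘ I` become
weighted counts in `D`.

If `t² > 30 p r²`, let `k` be a median level of the largest count in `B`. By a union bound, unless
`k = 0`, some letter of `B`, of probability `q`, reaches `k` with probability more than `q/2`. Total
positivity of binomial laws transfers this to a lower bound of order `t²/r²` on the tail of `a`
(`le_twoStageTail_of_lt`), in which `q` cancels; a further bonus of mass raises the level to `k + 1`
(`twoStageTail_succ_ge`). Finally, a large count of `a` and small counts on `B` are positively
associated (`twoStage_real_mul_le`), so both happen together. -/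

/-! ### Products of a probability measure on a countable space -/

/-- The law of `m` i.i.d. samples of `P`. -/
noncomputable abbrev iidMeasure {α : Type*} [MeasurableSpace α] (P : Measure α) (m : ℕ) :
    Measure (Fin m → α) :=
  Measure.pi fun _ => P

section Basic

variable {α : Type*} [MeasurableSpace α]

lemma integrable_of_bdd [DiscreteMeasurableSpace α] [Countable α] {P : Measure α}
    [IsFiniteMeasure P] {f : α → ℝ} {C : ℝ} (hf : ∀ x, |f x| ≤ C) : Integrable f P :=
  Integrable.of_bound (Measurable.of_discrete).aestronglyMeasurable C
    (Filter.Eventually.of_forall fun x => by simpa using hf x)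

lemma abs_integral_le_of_bdd {P : Measure α} [IsProbabilityMeasure P] {f : α → ℝ} {C : ℝ}
    (hf : ∀ x, |f x| ≤ C) : |∫ x, f x ∂P| ≤ C := by
  have := norm_integral_le_of_norm_le_const (μ := P) (f := f) (C := C)
    (Filter.Eventually.of_forall fun x => by simpa using hf x)
  simpa using this

lemma integral_iid_zero {P : Measure α} [IsProbabilityMeasure P] (f : (Fin 0 → α) → ℝ) :
    ∫ s, f s ∂iidMeasure P 0 = f ![] := by
  rw [iidMeasure, Measure.pi_of_empty (fun _ => P) ![]]
  simp

lemma abs_measureReal_le_one {P : Measure α} [IsProbabilityMeasure P] (E : Set α) :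
    |P.real E| ≤ 1 := by
  rw [abs_of_nonneg measureReal_nonneg]
  exact measureReal_le_one

variable [Countable α] [MeasurableSingletonClass α]

lemma integral_iid_succ {P : Measure α} [IsProbabilityMeasure P] {m : ℕ}
    {f : (Fin (m + 1) → α) → ℝ} {C : ℝ} (hf : ∀ s, |f s| ≤ C) :
    ∫ s, f s ∂iidMeasure P (m + 1) = ∫ z, ∫ s, f (Fin.cons z s) ∂iidMeasure P m ∂P := by
  have h := (measurePreserving_piFinSuccAbove (fun _ : Fin (m + 1) => P) 0).symm
  rw [← h.integral_comp' f]
  rw [integral_prod]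
  · simp [MeasurableEquiv.piFinSuccAbove_symm_apply, Fin.insertNthEquiv, Fin.insertNth_zero']
  · exact integrable_of_bdd (C := C) fun x => hf _

lemma real_eq_integral_indicator {P : Measure α} (E : Set α) :
    P.real E = ∫ s, E.indicator (fun _ => (1 : ℝ)) s ∂P := by
  rw [integral_indicator (Set.to_countable E).measurableSet]
  simp

lemma abs_indicator_one_le {β : Type*} (E : Set β) (s : β) :
    |E.indicator (fun _ => (1 : ℝ)) s| ≤ 1 := by
  by_cases h : s ∈ E <;> simp [h]

lemma real_iid_succ {P : Measure α} [IsProbabilityMeasure P] {m : ℕ}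
    (E : Set (Fin (m + 1) → α)) :
    (iidMeasure P (m + 1)).real E = ∫ z, (iidMeasure P m).real {s | Fin.cons z s ∈ E} ∂P := by
  rw [real_eq_integral_indicator, integral_iid_succ (abs_indicator_one_le E)]
  congr 1
  ext z
  rw [real_eq_integral_indicator]
  rfl

/-- Chebyshev's association inequality. -/
lemma integral_mul_integral_le_of_comonotone {P : Measure α} [IsProbabilityMeasure P]
    {u v : α → ℝ} {C : ℝ} (hu : ∀ z, |u z| ≤ C) (hv : ∀ z, |v z| ≤ C)
    (h : ∀ z z', 0 ≤ (u z - u z') * (v z - v z')) :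
    (∫ z, u z ∂P) * ∫ z, v z ∂P ≤ ∫ z, u z * v z ∂P := by
  have iu : Integrable u P := integrable_of_bdd hu
  have iv : Integrable v P := integrable_of_bdd hv
  have iuv : Integrable (fun z => u z * v z) P := integrable_of_bdd (C := C * C) fun z => by
    rw [abs_mul]
    exact mul_le_mul (hu z) (hv z) (abs_nonneg _) ((abs_nonneg _).trans (hu z))
  -- The hypothesis is averaged over an independent copy `z'`, and the result is then averaged over
  -- `z`.
  have key : ∀ z, 0 ≤ u z * v z - u z * (∫ z, v z ∂P) - v z * (∫ z, u z ∂P)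
      + ∫ z, u z * v z ∂P := by
    intro z
    have e : ∫ z', (u z - u z') * (v z - v z') ∂P = u z * v z - u z * (∫ z, v z ∂P)
        - v z * (∫ z, u z ∂P) + ∫ z, u z * v z ∂P := by
      have : ∀ z', (u z - u z') * (v z - v z')
          = u z * v z - u z * v z' - v z * u z' + u z' * v z' := fun z' => by ring
      simp only [this]
      rw [integral_add (by fun_prop) iuv, integral_sub (by fun_prop) (by fun_prop),
        integral_sub (by fun_prop) (by fun_prop), integral_const_mul (u z) v, integral_const_mul (v z) u]
      simp
    rw [← e]
    exact integral_nonneg fun z' => h z z'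
  have := integral_nonneg (μ := P) (f := fun z => u z * v z - u z * (∫ z, v z ∂P)
    - v z * (∫ z, u z ∂P) + ∫ z, u z * v z ∂P) key
  rw [integral_add (by fun_prop) (by fun_prop), integral_sub (by fun_prop) (by fun_prop),
    integral_sub (by fun_prop) (by fun_prop), integral_mul_const, integral_mul_const] at this
  simp only [integral_const, probReal_univ, smul_eq_mul, one_mul] at this
  linarith

/-- Positive association of a function of the hitting pattern of `A` with a function that grows
when a sample is moved into `A`. -/
lemma integral_iid_mul_le {P : Measure α} [IsProbabilityMeasure P] (A : Set α) {C : ℝ} :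
    ∀ {m : ℕ} {u v : (Fin m → α) → ℝ}, (∀ s, |u s| ≤ C) → (∀ s, |v s| ≤ C) →
      (∀ s s', (∀ i, s i ∈ A → s' i ∈ A) → u s ≤ u s') →
      (∀ s i a, a ∈ A → s i ∉ A → v s ≤ v (Function.update s i a)) →
      (∫ s, u s ∂iidMeasure P m) * ∫ s, v s ∂iidMeasure P m ≤ ∫ s, u s * v s ∂iidMeasure P m := by
  intro m
  induction m with
  | zero =>
    intro u v _ _ _ _
    simp only [integral_iid_zero]
    exact le_rfl
  | succ m ih =>
    intro u v hu hv hmu hmv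
    have huv : ∀ s, |u s * v s| ≤ C * C := fun s => by
      rw [abs_mul]
      exact mul_le_mul (hu s) (hv s) (abs_nonneg _) ((abs_nonneg _).trans (hu s))
    rw [integral_iid_succ hu, integral_iid_succ hv, integral_iid_succ huv]
    have hU : ∀ z, |∫ s, u (Fin.cons z s) ∂iidMeasure P m| ≤ C := fun z =>
      abs_integral_le_of_bdd fun s => hu _
    have hV : ∀ z, |∫ s, v (Fin.cons z s) ∂iidMeasure P m| ≤ C := fun z =>
      abs_integral_le_of_bdd fun s => hv _
    have iu : ∀ z, Integrable (fun s => u (Fin.cons z s)) (iidMeasure P m) := fun z =>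
      integrable_of_bdd fun s => hu _
    have iv : ∀ z, Integrable (fun s => v (Fin.cons z s)) (iidMeasure P m) := fun z =>
      integrable_of_bdd fun s => hv _
    have mU : ∀ z z', (z ∈ A → z' ∈ A) → ∫ s, u (Fin.cons z s) ∂iidMeasure P m
        ≤ ∫ s, u (Fin.cons z' s) ∂iidMeasure P m := fun z z' h =>
      integral_mono (iu z) (iu z') fun s => hmu _ _ fun i => by
        refine Fin.cases ?_ (fun j => ?_) i
        · simpa using h
        · simp
    have mV : ∀ z z', z ∉ A → z' ∈ A → ∫ s, v (Fin.cons z s) ∂iidMeasure P m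
        ≤ ∫ s, v (Fin.cons z' s) ∂iidMeasure P m := fun z z' h h' =>
      integral_mono (iv z) (iv z') fun s => by
        have := hmv (Fin.cons z s) 0 z' h' (by simpa using h)
        rwa [Fin.update_cons_zero] at this
    calc _ ≤ ∫ z, (∫ s, u (Fin.cons z s) ∂iidMeasure P m)
            * (∫ s, v (Fin.cons z s) ∂iidMeasure P m) ∂P := by
          refine integral_mul_integral_le_of_comonotone hU hV fun z z' => ?_
          -- The conditional mean of `u` depends only on whether `z ∈ A`, so the product vanishes
          -- unless exactly one of `z`, `z'` lies in `A`; nothing is needed about `v` in the other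
          -- cases.
          by_cases h : z ∈ A <;> by_cases h' : z' ∈ A
          · rw [le_antisymm (mU z z' fun _ => h') (mU z' z fun _ => h)]
            simp
          · exact mul_nonneg (sub_nonneg.2 (mU _ _ fun _ => h)) (sub_nonneg.2 (mV _ _ h' h))
          · exact mul_nonneg_of_nonpos_of_nonpos (sub_nonpos.2 (mU _ _ fun _ => h'))
              (sub_nonpos.2 (mV _ _ h h'))
          · rw [le_antisymm (mU z z' fun hz => absurd hz h) (mU z' z fun hz => absurd hz h')]
            simp
      _ ≤ _ := by
          refine integral_mono (integrable_of_bdd (C := C * C) fun z => ?_)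
            (integrable_of_bdd (C := C * C) fun z => ?_) fun z => ?_
          · rw [abs_mul]
            exact mul_le_mul (hU z) (hV z) (abs_nonneg _) ((abs_nonneg _).trans (hU z))
          · exact abs_integral_le_of_bdd fun s => huv _
          · refine ih (fun s => hu _) (fun s => hv _) (fun s s' h => hmu _ _ fun i => ?_)
              fun s i a ha hs => ?_
            · refine Fin.cases ?_ (fun j => ?_) i
              · simp
              · simpa using h j
            · have := hmv (Fin.cons z s) i.succ a ha (by simpa using hs)
              rwa [← Fin.cons_update] at this

lemma integral_eq_pair_add {P : Measure α} [IsProbabilityMeasure P] {a b : α} (hab : a ≠ b)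
    {g : α → ℝ} {C : ℝ} (hg : ∀ z, |g z| ≤ C) :
    ∫ z, g z ∂P = P.real {a} * g a + P.real {b} * g b + ∫ z in ({a, b} : Set α)ᶜ, g z ∂P := by
  rw [← integral_add_compl (Set.to_countable {a, b}).measurableSet (integrable_of_bdd hg)]
  congr 1
  have : ({a, b} : Set α) = {a} ∪ {b} := rfl
  rw [this, setIntegral_union (by simpa using hab) (measurableSet_singleton b)
    (integrable_of_bdd hg).integrableOn (integrable_of_bdd hg).integrableOn]
  simp [Measure.real]

open scoped Classical in
/-- If an event gets more likely as copies of `a` are turned into `b`, and excludes its image under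
the exchange of `a` and `b`, then exchanging the roles of `b` and a more likely `a` gains a factor
`P a / P b`. -/
lemma real_iid_swap {P : Measure α} [IsProbabilityMeasure P] {a b : α} (hab : a ≠ b)
    (hP : P.real {b} ≤ P.real {a}) : ∀ {m : ℕ} (E : Set (Fin m → α)),
      (∀ s i, s i = a → s ∈ E → Function.update s i b ∈ E) →
      (∀ s ∈ E, (fun i => Equiv.swap a b (s i)) ∉ E) →
      P.real {a} * (iidMeasure P m).real E
        ≤ P.real {b} * (iidMeasure P m).real {s | (fun i => Equiv.swap a b (s i)) ∈ E} := by
  intro m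
  induction m with
  | zero =>
    intro E _ hd
    -- The empty sample is fixed by the exchange, so it cannot lie in `E`.
    have : E = ∅ := by
      ext s
      simp only [Set.mem_empty_iff_false, iff_false]
      intro hs
      refine hd s hs ?_
      convert hs
    simp [this]
  | succ m ih =>
    intro E hm hd
    set σ := Equiv.swap a b with hσ
    have hσ2 : ∀ z, σ (σ z) = z := Equiv.swap_apply_self a b
    let sec : α → Set (Fin m → α) := fun z => {s | Fin.cons z s ∈ E}
    let sw : Set (Fin m → α) → Set (Fin m → α) := fun F => {s | (fun i => σ (s i)) ∈ F}
    have hcomp : ∀ (z : α) (s : Fin m → α),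
        (fun i => σ ((Fin.cons z s : Fin (m + 1) → α) i)) = Fin.cons (σ z) (fun i => σ (s i)) := by
      intro z s
      ext i
      refine Fin.cases ?_ (fun j => ?_) i <;> simp
    have hswsec : ∀ z, {s | Fin.cons z s ∈ {s : Fin (m + 1) → α | (fun i => σ (s i)) ∈ E}}
        = sw (sec (σ z)) := by
      intro z
      ext s
      simp only [Set.mem_ofPred_eq, hcomp, sw, sec]
    have secm : ∀ z s i, s i = a → s ∈ sec z → Function.update s i b ∈ sec z := by
      intro z s i hi hs
      have := hm (Fin.cons z s) i.succ (by simpa using hi) hs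
      rwa [← Fin.cons_update] at this
    have hsub : sec a ⊆ sec b := by
      intro s hs
      have := hm (Fin.cons a s) 0 (by simp) hs
      rwa [Fin.update_cons_zero] at this
    have secd : ∀ z s, s ∈ sec z → (fun i => σ (s i)) ∉ sec (σ z) := by
      intro z s hs h
      apply hd _ hs
      rw [hcomp]
      exact h
    have swsw : ∀ F, sw (sw F) = F := by
      intro F
      ext s
      simp [sw, hσ2]
    rw [real_iid_succ, real_iid_succ]
    simp only [hswsec]
    change P.real {a} * ∫ z, (iidMeasure P m).real (sec z) ∂P ≤ _
    rw [integral_eq_pair_add (P := P) hab (C := 1)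
        (g := fun z => (iidMeasure P m).real (sec z)) (fun z => abs_measureReal_le_one _),
      integral_eq_pair_add (P := P) hab (C := 1)
        (g := fun z => (iidMeasure P m).real (sw (sec (σ z)))) (fun z => abs_measureReal_le_one _)]
    have hσa : σ a = b := Equiv.swap_apply_left a b
    have hσb : σ b = a := Equiv.swap_apply_right a b
    rw [hσa, hσb]
    have hrest : P.real {a} * ∫ z in ({a, b} : Set α)ᶜ, (iidMeasure P m).real (sec z) ∂P
        ≤ P.real {b} * ∫ z in ({a, b} : Set α)ᶜ, (iidMeasure P m).real (sw (sec (σ z))) ∂P := by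
      rw [← integral_const_mul, ← integral_const_mul]
      refine setIntegral_mono_on
        (integrable_of_bdd (C := 1 * 1) fun z => ?_).integrableOn
        (integrable_of_bdd (C := 1 * 1) fun z => ?_).integrableOn
        (Set.to_countable _).measurableSet fun z hz => ?_
      · rw [abs_mul]
        exact mul_le_mul (abs_measureReal_le_one _) (abs_measureReal_le_one _) (abs_nonneg _) one_pos.le
      · rw [abs_mul]
        exact mul_le_mul (abs_measureReal_le_one _) (abs_measureReal_le_one _) (abs_nonneg _) one_pos.le
      · have hz' : z ≠ a ∧ z ≠ b := by simpa [not_or] using hz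
        have : σ z = z := Equiv.swap_apply_of_ne_of_ne hz'.1 hz'.2
        rw [this]
        refine ih (sec z) (secm z) fun s hs => ?_
        have := secd z s hs
        rwa [‹σ z = z›] at this
    -- the two exchanged letters
    set F : Set (Fin m → α) := sec b \ sw (sec b) with hF
    have hFa : sec a ⊆ F := fun s hs => ⟨hsub hs, fun h => by
      have := secd a s hs
      rw [hσa] at this
      exact this h⟩
    have ha := ih (sec a) (secm a) fun s hs h => by
      have := secd a s hs
      rw [hσa] at this
      exact this (hsub h)
    -- The induction hypothesis does not apply to `sec b`, which may meet its own image under the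
    -- exchange. Removing that image gives `F`, and, since the removed intersection is common to
    -- both sides, leaves the difference of the two probabilities unchanged (`e1`).
    have hFineq := ih F (by
        intro s i hi hs
        refine ⟨secm b s i hi hs.1, fun h => hs.2 ?_⟩
        have h1 : (fun j => σ (Function.update s i b j)) ∈ sec b := h
        have h2 := secm b _ i (by simp [hσb]) h1
        change (fun j => σ (s j)) ∈ sec b
        convert h2 using 1
        ext j
        by_cases hj : j = i
        · subst hj
          simp [hi, hσa]
        · simp [hj])
      (by
        intro s hs h
        apply hs.2
        exact h.1)
    have hswF : sw F = sw (sec b) \ sec b := by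
      have : sw F = sw (sec b) \ sw (sw (sec b)) := rfl
      rw [this, swsw]
    have e1 : (iidMeasure P m).real (sec b) - (iidMeasure P m).real (sw (sec b))
        = (iidMeasure P m).real F - (iidMeasure P m).real (sw F) := by
      have h1 := measureReal_sdiff_add_inter (μ := iidMeasure P m) (s := sec b)
        (t := sw (sec b)) (Set.to_countable _).measurableSet
      have h2 := measureReal_sdiff_add_inter (μ := iidMeasure P m) (s := sw (sec b))
        (t := sec b) (Set.to_countable _).measurableSet
      rw [Set.inter_comm] at h2
      rw [hswF, hF]
      linarith
    have e2 : (iidMeasure P m).real (sec a) ≤ (iidMeasure P m).real F := measureReal_mono hFa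
    have ha' : P.real {a} * (iidMeasure P m).real (sec a)
        ≤ P.real {b} * (iidMeasure P m).real (sw (sec a)) := ha
    have hF' : P.real {a} * (iidMeasure P m).real F
        ≤ P.real {b} * (iidMeasure P m).real (sw F) := hFineq
    have pa : 0 ≤ P.real {a} := measureReal_nonneg
    have pb : 0 ≤ P.real {b} := measureReal_nonneg
    generalize (iidMeasure P m).real (sec a) = x at *
    generalize (iidMeasure P m).real (sw (sec a)) = x' at *
    generalize (iidMeasure P m).real F = y at *
    generalize (iidMeasure P m).real (sw F) = y' at *
    generalize (iidMeasure P m).real (sec b) = w at *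
    generalize (iidMeasure P m).real (sw (sec b)) = w' at *
    generalize P.real {a} = p at *
    generalize P.real {b} = q at *
    -- Apart from the other letters, the goal is `p (p x + q w) ≤ q (p w' + q x')`. With `w - w' = y
    -- - y'` and the two induction hypotheses, it reduces to `p (p - q) (y - x) ≥ 0`, which is where
    -- `sec a ⊆ F` enters.
    have h1 : p * (p * y) ≤ p * (q * y') := mul_le_mul_of_nonneg_left hF' pa
    have h2 : q * (p * x) ≤ q * (q * x') := mul_le_mul_of_nonneg_left ha' pb
    have h3 : 0 ≤ p * (p - q) * (y - x) :=
      mul_nonneg (mul_nonneg pa (sub_nonneg.2 hP)) (sub_nonneg.2 e2)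
    have h4 : p * q * (w - w') = p * q * (y - y') := by rw [e1]
    linarith

end Basic

/-! ### Mixtures with a point mass -/

/-- The Bernoulli law with parameter `τ` on `Bool`. -/
noncomputable def bern (τ : ℝ) : Measure Bool :=
  ENNReal.ofReal (1 - τ) • Measure.dirac false + ENNReal.ofReal τ • Measure.dirac true

lemma isProbabilityMeasure_bern {τ : ℝ} (h0 : 0 ≤ τ) (h1 : τ ≤ 1) :
    IsProbabilityMeasure (bern τ) := by
  refine ⟨?_⟩
  simp only [bern, Measure.add_apply, Measure.smul_apply, measure_univ, smul_eq_mul, mul_one]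
  rw [← ENNReal.ofReal_add (by linarith) h0]
  simp

/-- The sample `s`, with the entries marked by `e` replaced by `a`. -/
def overwrite {α : Type*} {m : ℕ} (a : α) (e : Fin m → Bool) (s : Fin m → α) : Fin m → α :=
  fun i => if e i then a else s i

lemma overwrite_cons {α : Type*} {m : ℕ} (a : α) (b : Bool) (e : Fin m → Bool) (z : α)
    (s : Fin m → α) : overwrite a (Fin.cons b e : Fin (m + 1) → Bool) (Fin.cons z s)
      = Fin.cons (if b then a else z) (overwrite a e s) := by
  ext i
  refine Fin.cases ?_ (fun j => ?_) i <;> simp [overwrite]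

section Mixture

variable {α : Type*} [MeasurableSpace α] [Countable α] [MeasurableSingletonClass α]

lemma integral_mix {P P₀ : Measure α} [IsProbabilityMeasure P₀] {a : α} {τ : ℝ} (h0 : 0 ≤ τ)
    (h1 : τ ≤ 1) (hP : P = ENNReal.ofReal (1 - τ) • P₀ + ENNReal.ofReal τ • Measure.dirac a)
    {g : α → ℝ} {C : ℝ} (hg : ∀ z, |g z| ≤ C) :
    ∫ z, g z ∂P = (1 - τ) * ∫ z, g z ∂P₀ + τ * g a := by
  have i1 : Integrable g P₀ := integrable_of_bdd hg
  have i2 : Integrable g (Measure.dirac a) := integrable_of_bdd hg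
  rw [hP, integral_add_measure (i1.smul_measure (by simp)) (i2.smul_measure (by simp)),
    integral_smul_measure, integral_smul_measure, integral_dirac,
    ENNReal.toReal_ofReal (by linarith), ENNReal.toReal_ofReal h0]
  simp

lemma integral_bern {τ : ℝ} (h0 : 0 ≤ τ) (h1 : τ ≤ 1) (g : Bool → ℝ) :
    ∫ z, g z ∂bern τ = (1 - τ) * g false + τ * g true := by
  rw [integral_mix (P := bern τ) (P₀ := Measure.dirac false) (a := true) h0 h1 rfl
    (C := |g true| + |g false|)]
  · simp
  · intro z
    cases z <;> simp

/-- A draw from the mixture is a draw from `P₀` that an independent coin of bias `τ` replaces by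
`a`. Doing this at every position couples the two product laws. -/
lemma integral_iid_mix {P P₀ : Measure α} [IsProbabilityMeasure P] [IsProbabilityMeasure P₀]
    {a : α} {τ : ℝ} (h0 : 0 ≤ τ) (h1 : τ ≤ 1)
    (hP : P = ENNReal.ofReal (1 - τ) • P₀ + ENNReal.ofReal τ • Measure.dirac a) {C : ℝ} :
    ∀ {m : ℕ} {f : (Fin m → α) → ℝ}, (∀ s, |f s| ≤ C) →
      ∫ s, f s ∂iidMeasure P m
        = ∫ s, ∫ e, f (overwrite a e s) ∂iidMeasure (bern τ) m ∂iidMeasure P₀ m := by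
  have := isProbabilityMeasure_bern h0 h1
  intro m
  induction m with
  | zero =>
    intro f _
    simp only [integral_iid_zero]
    congr 1
    exact Subsingleton.elim _ _
  | succ m ih =>
    intro f hf
    have hin : ∀ s : Fin (m + 1) → α,
        |∫ e, f (overwrite a e s) ∂iidMeasure (bern τ) (m + 1)| ≤ C := fun s =>
      abs_integral_le_of_bdd fun e => hf _
    rw [integral_iid_succ hf, integral_iid_succ hin,
      integral_mix h0 h1 hP (C := C) fun z => abs_integral_le_of_bdd fun s => hf _]
    have step : ∀ z s, ∫ e, f (overwrite a e (Fin.cons z s)) ∂iidMeasure (bern τ) (m + 1)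
        = (1 - τ) * ∫ e, f (Fin.cons z (overwrite a e s)) ∂iidMeasure (bern τ) m
          + τ * ∫ e, f (Fin.cons a (overwrite a e s)) ∂iidMeasure (bern τ) m := by
      intro z s
      rw [integral_iid_succ (fun e => hf _), integral_bern h0 h1]
      simp [overwrite_cons]
    simp only [step]
    have e1 : ∀ z, ∫ s, ((1 - τ) * ∫ e, f (Fin.cons z (overwrite a e s)) ∂iidMeasure (bern τ) m
          + τ * ∫ e, f (Fin.cons a (overwrite a e s)) ∂iidMeasure (bern τ) m) ∂iidMeasure P₀ m
        = (1 - τ) * ∫ s, f (Fin.cons z s) ∂iidMeasure P m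
          + τ * ∫ s, f (Fin.cons a s) ∂iidMeasure P m := by
      intro z
      rw [ih (fun s => hf _), ih (fun s => hf _), integral_add, integral_const_mul,
        integral_const_mul]
      all_goals
        refine Integrable.const_mul (integrable_of_bdd (C := C) fun s => ?_) _
        exact abs_integral_le_of_bdd fun e => hf _
    simp only [e1]
    rw [integral_add, integral_const_mul]
    · simp
    · exact Integrable.const_mul (integrable_of_bdd (C := C) fun s =>
        abs_integral_le_of_bdd fun e => hf _) _
    · exact integrable_const _

/-- The form in which the coupling is used: every good sample of `P₀` is carried into `U` by the
overwriting with conditional probability at least `κ`. -/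
lemma mul_real_iid_le_of_mix {P P₀ : Measure α} [IsProbabilityMeasure P] [IsProbabilityMeasure P₀]
    {a : α} {τ : ℝ} (h0 : 0 ≤ τ) (h1 : τ ≤ 1)
    (hP : P = ENNReal.ofReal (1 - τ) • P₀ + ENNReal.ofReal τ • Measure.dirac a) {m : ℕ}
    {W U : Set (Fin m → α)} {κ : ℝ}
    (h : ∀ s ∈ W, κ ≤ (iidMeasure (bern τ) m).real {e | overwrite a e s ∈ U}) :
    κ * (iidMeasure P₀ m).real W ≤ (iidMeasure P m).real U := by
  have := isProbabilityMeasure_bern h0 h1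
  rw [real_eq_integral_indicator W, real_eq_integral_indicator U,
    integral_iid_mix h0 h1 hP (abs_indicator_one_le U), ← integral_const_mul]
  refine integral_mono ((integrable_of_bdd (abs_indicator_one_le W)).const_mul κ)
    (integrable_of_bdd (C := 1) fun s => abs_integral_le_of_bdd fun e => abs_indicator_one_le _ _)
    fun s => ?_
  have e : ∫ e, U.indicator (fun _ => (1 : ℝ)) (overwrite a e s) ∂iidMeasure (bern τ) m
      = (iidMeasure (bern τ) m).real {e | overwrite a e s ∈ U} := by
    rw [real_eq_integral_indicator]
    rfl
  simp only [e]
  by_cases hs : s ∈ W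
  · simpa [hs] using h s hs
  · simp [hs]

lemma real_iid_bern_miss {τ : ℝ} (h0 : 0 ≤ τ) (h1 : τ ≤ 1) {m : ℕ} (H : Finset (Fin m)) :
    (iidMeasure (bern τ) m).real {e | ∀ i ∈ H, e i = false} = (1 - τ) ^ H.card := by
  have := isProbabilityMeasure_bern h0 h1
  have e : {e : Fin m → Bool | ∀ i ∈ H, e i = false}
      = Set.pi Set.univ fun i => if i ∈ H then {false} else Set.univ := by
    ext e
    simp only [Set.mem_ofPred_eq, Set.mem_pi, Set.mem_univ, true_imp_iff]
    refine forall_congr' fun i => ?_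
    by_cases hi : i ∈ H <;> simp [hi]
  rw [e, Measure.real, Measure.pi_pi, ENNReal.toReal_prod]
  have : ∀ i, (bern τ (if i ∈ H then {false} else Set.univ)).toReal
      = if i ∈ H then 1 - τ else 1 := by
    intro i
    by_cases hi : i ∈ H
    · simp [hi, bern, ENNReal.toReal_ofReal (sub_nonneg.2 h1)]
    · rw [if_neg hi, if_neg hi, measure_univ, ENNReal.toReal_one]
  simp only [this]
  rw [Finset.prod_ite]
  simp

lemma one_sub_pow_le_real_hit {τ : ℝ} (h0 : 0 ≤ τ) (h1 : τ ≤ 1) {m : ℕ} (H : Finset (Fin m))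
    {E : Set (Fin m → Bool)} (hE : ∀ e, (∃ i ∈ H, e i = true) → e ∈ E) :
    1 - (1 - τ) ^ H.card ≤ (iidMeasure (bern τ) m).real E := by
  have := isProbabilityMeasure_bern h0 h1
  rw [← real_iid_bern_miss h0 h1 H, ← probReal_compl_eq_one_sub (Set.to_countable _).measurableSet]
  refine measureReal_mono fun e he => hE e ?_
  simpa using he

lemma one_sub_pow_mul_le {τ : ℝ} (h0 : 0 ≤ τ) (h1 : τ ≤ 1) (h : ℕ) :
    (1 - τ) ^ h * (1 + h * τ) ≤ 1 := by
  calc (1 - τ) ^ h * (1 + h * τ) ≤ (1 - τ) ^ h * (1 + τ) ^ h :=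
        mul_le_mul_of_nonneg_left (one_add_mul_le_pow (by linarith) h) (pow_nonneg (by linarith) _)
    _ = (1 - τ ^ 2) ^ h := by rw [← mul_pow]; ring
    _ ≤ 1 := pow_le_one₀ (by nlinarith) (by nlinarith)

/-- Removing a part of an atom of a probability measure. -/
lemma exists_eq_mix (P : Measure α) [IsProbabilityMeasure P] (a : α) {τ : ℝ}
    (h0 : 0 ≤ τ) (h1 : τ < 1) (ha : τ ≤ P.real {a}) :
    ∃ P₀ : Measure α, IsProbabilityMeasure P₀ ∧
      P = ENNReal.ofReal (1 - τ) • P₀ + ENNReal.ofReal τ • Measure.dirac a ∧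
      P₀.real {a} = (P.real {a} - τ) / (1 - τ) ∧
      ∀ y, y ≠ a → P₀.real {y} = P.real {y} / (1 - τ) := by
  have hτ : 0 < 1 - τ := by linarith
  -- `Q` is `P` with mass `τ` removed at `a`, before normalisation by `1 - τ`.
  set Q : Measure α := P.restrict {a}ᶜ + ENNReal.ofReal (P.real {a} - τ) • Measure.dirac a with hQ
  have hPQ : P = Q + ENNReal.ofReal τ • Measure.dirac a := by
    refine Measure.ext_of_singleton fun y => ?_
    by_cases hy : y = a
    · subst hy
      simp only [hQ, Measure.add_apply, Measure.smul_apply, smul_eq_mul,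
        Measure.restrict_apply (measurableSet_singleton y)]
      simp only [Set.inter_compl_self, measure_empty, zero_add, Measure.dirac_apply_of_mem
        (Set.mem_singleton y), mul_one]
      rw [← ENNReal.ofReal_add (by linarith) h0]
      simp
    · simp only [hQ, Measure.add_apply, Measure.smul_apply, smul_eq_mul,
        Measure.restrict_apply (measurableSet_singleton y)]
      have : ({y} : Set α) ∩ {a}ᶜ = {y} := by simpa using Ne.symm hy
      rw [this]
      simp [Ne.symm hy]
  have hfin : IsFiniteMeasure Q :=
    isFiniteMeasure_of_le P (by rw [hPQ]; exact Measure.le_add_right le_rfl)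
  refine ⟨ENNReal.ofReal (1 - τ)⁻¹ • Q, ⟨?_⟩, ?_, ?_, ?_⟩
  · have h : P.real Set.univ = Q.real Set.univ + τ := by
      conv_lhs => rw [hPQ]
      simp [Measure.real]
      rw [ENNReal.toReal_add (by finiteness) (by finiteness), ENNReal.toReal_ofReal h0]
    rw [probReal_univ] at h
    have hQu : Q Set.univ = ENNReal.ofReal (1 - τ) := by
      rw [← ENNReal.ofReal_toReal (a := Q Set.univ) (by finiteness)]
      congr 1
      change Q.real _ = _
      linarith
    rw [Measure.smul_apply, hQu, smul_eq_mul, ← ENNReal.ofReal_mul (by positivity)]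
    field_simp
    simp
  · rw [smul_smul, ← ENNReal.ofReal_mul hτ.le, mul_inv_cancel₀ hτ.ne']
    simpa using hPQ
  · have h : P.real {a} = Q.real {a} + τ := by
      conv_lhs => rw [hPQ]
      simp [Measure.real]
      rw [ENNReal.toReal_add (by finiteness) (by finiteness), ENNReal.toReal_ofReal h0]
    simp only [measureReal_ennreal_smul_apply]
    rw [ENNReal.toReal_ofReal (by positivity), eq_div_iff hτ.ne']
    field_simp
    linarith
  · intro y hy
    have h : P.real {y} = Q.real {y} := by
      conv_lhs => rw [hPQ]
      simp [Measure.real, Ne.symm hy]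
    simp only [measureReal_ennreal_smul_apply]
    rw [ENNReal.toReal_ofReal (by positivity), h]
    field_simp

end Mixture

/-! ### The most likely letter in a weighted sample -/

open scoped Classical in
/-- The total weight of the positions of `s` that hold the letter `y`. -/
noncomputable def weightedCount {α : Type*} {m : ℕ} (w : Fin m → ℕ) (s : Fin m → α) (y : α) : ℕ :=
  ∑ i, if s i = y then w i else 0

lemma tsum_measure_singleton_subtype {α : Type*} [MeasurableSpace α] [Countable α]
    [MeasurableSingletonClass α] (P : Measure α) (B : Set α) :
    ∑' y : B, P {(y : α)} = P B := by
  rw [← measure_biUnion (f := fun y : α => {y}) (Set.to_countable B)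
    (fun x _ y _ h => by simpa using h) fun _ _ => measurableSet_singleton _,
    Set.biUnion_of_singleton]

section WeightedCount

variable {α : Type*} {m : ℕ} (w : Fin m → ℕ)

lemma weightedCount_le (s : Fin m → α) (y : α) : weightedCount w s y ≤ ∑ i, w i :=
  Finset.sum_le_sum fun i _ => by split_ifs <;> simp

lemma weightedCount_mono {s s' : Fin m → α} {y y' : α} (h : ∀ i, s i = y → s' i = y') :
    weightedCount w s y ≤ weightedCount w s' y' :=
  Finset.sum_le_sum fun i _ => by
    by_cases hi : s i = y
    · simp [hi, h i hi]
    · simp [hi]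

lemma weightedCount_lt {s s' : Fin m → α} {y y' : α} (h : ∀ i, s i = y → s' i = y') {i : Fin m}
    (hi : s i ≠ y) (hi' : s' i = y') (hw : 0 < w i) :
    weightedCount w s y < weightedCount w s' y' := by
  refine Finset.sum_lt_sum (fun j _ => ?_) ⟨i, Finset.mem_univ _, ?_⟩
  · by_cases hj : s j = y
    · simp [hj, h j hj]
    · simp [hj]
  · simpa [hi, hi'] using hw

open scoped Classical in
lemma weightedCount_add_compl (s : Fin m → α) (y : α) :
    weightedCount w s y + ∑ i with s i ≠ y, w i = ∑ i, w i := by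
  rw [weightedCount, Finset.sum_filter, ← Finset.sum_add_distrib]
  exact Finset.sum_congr rfl fun i _ => by by_cases h : s i = y <;> simp [h]

lemma weightedCount_add_le {s : Fin m → α} {y z : α} (h : y ≠ z) :
    weightedCount w s y + weightedCount w s z ≤ ∑ i, w i := by
  rw [weightedCount, weightedCount, ← Finset.sum_add_distrib]
  refine Finset.sum_le_sum fun i _ => ?_
  by_cases hy : s i = y
  · simp [hy, h]
  · simp only [hy, if_false, zero_add]
    split_ifs <;> simp

lemma exists_weightedCount_max (s : Fin m → α) {B : Set α} (hB : B.Nonempty) :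
    ∃ y ∈ B, ∀ z ∈ B, weightedCount w s z ≤ weightedCount w s y := by
  have hb : BddAbove (weightedCount w s '' B) :=
    ⟨∑ i, w i, by rintro _ ⟨y, _, rfl⟩; exact weightedCount_le w s y⟩
  obtain ⟨y, hy, hy'⟩ := Nat.sSup_mem (hB.image _) hb
  exact ⟨y, hy, fun z hz => hy' ▸ le_csSup hb ⟨z, hz, rfl⟩⟩

variable [MeasurableSpace α] [Countable α] [MeasurableSingletonClass α]

/-- A letter `a` that is at least as likely as each letter of `B` is a most frequent one
with probability at least `P a`, in any weighting of the sample. -/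
lemma real_singleton_le_real_weightedCount_max {P : Measure α} [IsProbabilityMeasure P] {a : α}
    {B : Set α} (ha : a ∉ B) (hB : ∀ y ∈ B, P.real {y} ≤ P.real {a}) :
    P.real {a} ≤ (iidMeasure P m).real
      {s | ∀ y ∈ B, weightedCount w s y ≤ weightedCount w s a} := by
  classical
  set W := {s : Fin m → α | ∀ y ∈ B, weightedCount w s y ≤ weightedCount w s a} with hW
  let Q : α → Set (Fin m → α) := fun y => {s | weightedCount w s a < weightedCount w s y ∧
    ∀ z ∈ B, weightedCount w s z ≤ weightedCount w s y}
  have hcov : Wᶜ ⊆ ⋃ y ∈ B, Q y := by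
    intro s hs
    simp only [hW, Set.mem_compl_iff, Set.mem_ofPred_eq, not_forall, not_le] at hs
    obtain ⟨z, hz, hlt⟩ := hs
    obtain ⟨y, hy, hmax⟩ := exists_weightedCount_max w s ⟨z, hz⟩
    simp only [Set.mem_iUnion]
    exact ⟨y, hy, hlt.trans_le (hmax z hz), hmax⟩
  -- On `Q y`, the letter `y` beats `a` and is maximal within `B`. Exchanging `a` and `y` makes `a`
  -- maximal, so the image of `Q y` lies in `W`. A pointwise comparison of likelihoods would not do:
  -- with unequal weights, a larger weighted count need not mean more occurrences.
  have hQ : ∀ y ∈ B, P.real {a} * (iidMeasure P m).real (Q y)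
      ≤ P.real {y} * (iidMeasure P m).real W := by
    intro y hy
    have hay : a ≠ y := fun h => ha (h ▸ hy)
    refine (real_iid_swap hay (hB y hy) (Q y) ?_ ?_).trans ?_
    · intro s i hi hs
      have h1 : weightedCount w (Function.update s i y) a ≤ weightedCount w s a :=
        weightedCount_mono w fun j hj => by
          by_cases hji : j = i
          · subst hji; exact hi
          · simpa [hji] using hj
      have h2 : weightedCount w s y ≤ weightedCount w (Function.update s i y) y :=
        weightedCount_mono w fun j hj => by
          by_cases hji : j = i
          · subst hji; simp
          · simpa [hji] using hj
      refine ⟨h1.trans_lt (hs.1.trans_le h2), fun z hz => ?_⟩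
      by_cases hzy : z = y
      · rw [hzy]
      · refine le_trans ?_ ((hs.2 z hz).trans h2)
        exact weightedCount_mono w fun j hj => by
          by_cases hji : j = i
          · subst hji; simp [Ne.symm hzy] at hj
          · simpa [hji] using hj
    · intro s hs h
      have e1 : weightedCount w (fun i => Equiv.swap a y (s i)) a = weightedCount w s y := by
        refine Finset.sum_congr rfl fun i _ => ?_
        simp [Equiv.swap_apply_eq_iff]
      have e2 : weightedCount w (fun i => Equiv.swap a y (s i)) y = weightedCount w s a := by
        refine Finset.sum_congr rfl fun i _ => ?_
        simp [Equiv.swap_apply_eq_iff]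
      have := h.1
      rw [e1, e2] at this
      exact absurd hs.1 (not_lt.2 this.le)
    · refine mul_le_mul_of_nonneg_left (measureReal_mono ?_) measureReal_nonneg
      intro s hs z hz
      have e1 : weightedCount w (fun i => Equiv.swap a y (s i)) a = weightedCount w s y := by
        refine Finset.sum_congr rfl fun i _ => ?_
        simp [Equiv.swap_apply_eq_iff]
      have e2 : weightedCount w (fun i => Equiv.swap a y (s i)) y = weightedCount w s a := by
        refine Finset.sum_congr rfl fun i _ => ?_
        simp [Equiv.swap_apply_eq_iff]
      have h1 := hs.1
      rw [e1, e2] at h1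
      by_cases hzy : z = y
      · rw [hzy]; exact h1.le
      · have hza : z ≠ a := fun h => ha (h ▸ hz)
        have := hs.2 z hz
        rw [e2] at this
        refine le_trans (le_of_eq ?_) this
        refine Finset.sum_congr rfl fun i _ => ?_
        simp [Equiv.swap_apply_eq_iff, Equiv.swap_apply_of_ne_of_ne hza hzy]
  have hQ' : ∀ y ∈ B, P {a} * iidMeasure P m (Q y) ≤ P {y} * iidMeasure P m W := by
    intro y hy
    have := hQ y hy
    simp only [Measure.real, ← ENNReal.toReal_mul] at this
    exact (ENNReal.toReal_le_toReal (by finiteness) (by finiteness)).1 this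
  have hmain : P {a} * iidMeasure P m Wᶜ ≤ P {a}ᶜ * iidMeasure P m W := by
    calc P {a} * iidMeasure P m Wᶜ ≤ P {a} * ∑' y : B, iidMeasure P m (Q y) := by
          gcongr
          exact (measure_mono hcov).trans (measure_biUnion_le _ (Set.to_countable B) _)
      _ = ∑' y : B, P {a} * iidMeasure P m (Q y) := ENNReal.tsum_mul_left.symm
      _ ≤ ∑' y : B, P {(y : α)} * iidMeasure P m W := ENNReal.tsum_le_tsum fun y => hQ' y y.2
      _ = (∑' y : B, P {(y : α)}) * iidMeasure P m W := ENNReal.tsum_mul_right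
      _ = P B * iidMeasure P m W := by
          rw [tsum_measure_singleton_subtype]
      _ ≤ P {a}ᶜ * iidMeasure P m W := by
          gcongr
          intro y hy h
          exact ha (h ▸ hy)
  -- With `p` and `w` the probabilities of `a` and `W`, this says `p (1 - w) ≤ (1 - p) w`, that is,
  -- `p ≤ w`.
  have hr : P.real {a} * (iidMeasure P m).real Wᶜ ≤ P.real {a}ᶜ * (iidMeasure P m).real W := by
    simp only [Measure.real, ← ENNReal.toReal_mul]
    exact (ENNReal.toReal_le_toReal (by finiteness) (by finiteness)).2 hmain
  rw [probReal_compl_eq_one_sub (Set.to_countable _).measurableSet,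
    probReal_compl_eq_one_sub (measurableSet_singleton a)] at hr
  linarith

/-- If `a` is more likely than each letter of `B` by at least `τ`, then it is strictly more frequent
in a weighted sample with a probability that is controlled by the squared weights. -/
lemma le_real_weightedCount_lt {P : Measure α} [IsProbabilityMeasure P] {a : α} {B : Set α}
    {τ : ℝ} (h0 : 0 < τ) (hτ : τ < P.real {a}) (hB : ∀ y ∈ B, P.real {y} ≤ P.real {a} - τ)
    (hw : 0 < ∑ i, w i) :
    (P.real {a} - τ) * (τ / (τ + 4 * ((∑ i, (w i : ℝ) ^ 2) / (∑ i, (w i : ℝ)) ^ 2)))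
      ≤ (iidMeasure P m).real {s | ∀ y ∈ B, weightedCount w s y < weightedCount w s a} := by
  classical
  have ha1 : P.real {a} ≤ 1 := measureReal_le_one
  have h1 : τ < 1 := hτ.trans_le ha1
  have ha : a ∉ B := fun h => by linarith [hB a h]
  -- Removing `τ` from `a` uses up the gap at most: under `P₀` the letter `a` is still at least as
  -- likely as each letter of `B`, and its mass is at least `P a - τ`.
  obtain ⟨P₀, hP₀, hP, hPa, hPy⟩ := exists_eq_mix P a h0.le h1 hτ.le
  have hWP := real_singleton_le_real_weightedCount_max w (P := P₀) ha (fun y hy => by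
    rw [hPa, hPy y (fun h => ha (h ▸ hy))]
    gcongr
    exact hB y hy)
  set A : ℝ := (∑ i, (w i : ℝ) ^ 2) / (∑ i, (w i : ℝ)) ^ 2 with hA
  have hn : (0 : ℝ) < ∑ i, (w i : ℝ) := by exact_mod_cast hw
  have hA0 : 0 ≤ A := by positivity
  have hκ : 0 ≤ τ / (τ + 4 * A) := by positivity
  have hpP₀ : P.real {a} - τ ≤ P₀.real {a} := by
    rw [hPa, le_div_iff₀ (by linarith)]
    nlinarith
  calc (P.real {a} - τ) * (τ / (τ + 4 * A)) ≤ P₀.real {a} * (τ / (τ + 4 * A)) := by gcongr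
    _ ≤ (iidMeasure P₀ m).real _ * (τ / (τ + 4 * A)) := by gcongr
    _ = τ / (τ + 4 * A) * (iidMeasure P₀ m).real _ := mul_comm _ _
    _ ≤ _ := mul_real_iid_le_of_mix h0.le h1.le hP fun s hs => ?_
  have keep : ∀ (e : Fin m → Bool), ∀ y ∈ B,
      weightedCount w (overwrite a e s) y ≤ weightedCount w s y := fun e y hy =>
    weightedCount_mono w fun i hi => by
      by_cases h : e i = true
      · simp [overwrite, h] at hi
        exact absurd (hi ▸ hy) ha
      · simpa [overwrite, h] using hi
  have grow : ∀ (e : Fin m → Bool) i, s i = a → overwrite a e s i = a := fun e i hi => by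
    by_cases h : e i = true <;> simp [overwrite, h, hi]
  by_cases hU : ∀ y ∈ B, weightedCount w s y < weightedCount w s a
  · have : {e | overwrite a e s ∈ {s | ∀ y ∈ B, weightedCount w s y < weightedCount w s a}}
        = Set.univ := by
      refine Set.eq_univ_of_forall fun e y hy => ?_
      exact (keep e y hy).trans_lt ((hU y hy).trans_le (weightedCount_mono w (grow e)))
    have hb := isProbabilityMeasure_bern h0.le h1.le
    rw [this, probReal_univ, div_le_one (by positivity)]
    linarith
  · simp only [not_forall, not_lt] at hU
    -- If `a` only ties, another letter carries as much weight, so the positions not holding `a`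
    -- carry at least half of the total. One overwritten position of positive weight among them
    -- breaks every tie.
    obtain ⟨y, hy, hle⟩ := hU
    set H : Finset (Fin m) := {i | s i ≠ a ∧ 0 < w i} with hH
    refine le_trans ?_ (one_sub_pow_le_real_hit h0.le h1.le H fun e he z hz => ?_)
    · have hhalf : (∑ i, (w i : ℝ)) ≤ 2 * ∑ i ∈ H, (w i : ℝ) := by
        have hya : y ≠ a := fun h => ha (h ▸ hy)
        have e1 := weightedCount_add_le w (s := s) hya
        have e2 := weightedCount_add_compl w s a
        have e3 : ∑ i with s i ≠ a, w i = ∑ i ∈ H, w i := by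
          rw [hH, ← Finset.filter_filter]
          refine (Finset.sum_subset (Finset.filter_subset _ _) fun i hi hi' => ?_).symm
          simp only [Finset.mem_filter, not_and, not_lt] at hi'
          exact Nat.le_zero.1 (hi' (by simpa using hi))
        have : ∑ i, w i ≤ 2 * ∑ i ∈ H, w i := by omega
        exact_mod_cast this
      -- Cauchy–Schwarz turns half of the weight into many positions, `H.card ≥ 1 / (4 A)`. The
      -- chance of missing all of them is at most `1 / (1 + H.card * τ)`, which gives the stated `τ
      -- / (τ + 4 A)`.
      have hcs : (∑ i ∈ H, (w i : ℝ)) ^ 2 ≤ H.card * ∑ i, (w i : ℝ) ^ 2 :=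
        sq_sum_le_card_mul_sum_sq.trans (by
          gcongr
          exact Finset.subset_univ H)
      have hcard : 1 ≤ 4 * (H.card * A) := by
        rw [hA, ← mul_div_assoc, ← mul_div_assoc, le_div_iff₀ (by positivity)]
        nlinarith
      have hp := one_sub_pow_mul_le h0.le h1.le H.card
      have hq : (0 : ℝ) ≤ (1 - τ) ^ H.card := pow_nonneg (by linarith) _
      rw [div_le_iff₀ (by positivity)]
      have hcA : (0 : ℝ) ≤ H.card := by positivity
      have h2 : (1 - τ) ^ H.card * (τ + 4 * A) ≤ 4 * A := by
        have : (1 - τ) ^ H.card * (τ + 4 * A) ≤ (1 - τ) ^ H.card * ((1 + H.card * τ) * (4 * A)) := by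
          gcongr
          nlinarith
        calc _ ≤ _ := this
          _ = ((1 - τ) ^ H.card * (1 + H.card * τ)) * (4 * A) := by ring
          _ ≤ 1 * (4 * A) := by gcongr
          _ = _ := one_mul _
      nlinarith
    · obtain ⟨i, hi, hei⟩ := he
      simp only [hH, Finset.mem_filter, Finset.mem_univ, true_and] at hi
      refine (keep e z hz).trans_lt ((hs z hz).trans_lt ?_)
      exact weightedCount_lt w (grow e) hi.1 (by simp [overwrite, hei]) hi.2

end WeightedCount

/-! ### Binomial expectations -/

/-- The expectation of `φ` under the binomial law with parameters `m` and `p`. -/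
noncomputable def binomialSum (m : ℕ) (p : ℝ) (φ : ℕ → ℝ) : ℝ :=
  ∑ d ∈ Finset.range (m + 1), (m.choose d : ℝ) * p ^ d * (1 - p) ^ (m - d) * φ d

lemma binomialSum_succ (m : ℕ) (p : ℝ) (φ : ℕ → ℝ) :
    binomialSum (m + 1) p φ
      = (1 - p) * binomialSum m p φ + p * binomialSum m p (fun d => φ (d + 1)) := by
  have e1 : (1 - p) * binomialSum m p φ = (1 - p) ^ (m + 1) * φ 0
      + ∑ d ∈ Finset.range (m + 1),
        (m.choose (d + 1) : ℝ) * p ^ (d + 1) * (1 - p) ^ (m - d) * φ (d + 1) := by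
    rw [binomialSum, Finset.sum_range_succ', Finset.sum_range_succ]
    simp only [Nat.choose_succ_self, Nat.cast_zero, zero_mul, add_zero, mul_add, Finset.mul_sum,
      Nat.choose_zero_right, Nat.cast_one, pow_zero, one_mul, Nat.sub_zero]
    rw [add_comm]
    congr 1
    · ring
    · refine Finset.sum_congr rfl fun d hd => ?_
      have : m - d = m - (d + 1) + 1 := by
        have := Finset.mem_range.1 hd
        omega
      rw [this]
      ring
  rw [e1, binomialSum, Finset.sum_range_succ', binomialSum, Finset.mul_sum, add_right_comm,
    add_assoc, add_comm]
  simp only [Nat.choose_zero_right, Nat.cast_one, pow_zero, one_mul, Nat.sub_zero]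
  rw [add_left_cancel_iff, ← Finset.sum_add_distrib]
  refine Finset.sum_congr rfl fun d _ => ?_
  rw [Nat.choose_succ_succ, Nat.add_sub_add_right]
  push_cast
  ring

lemma binomialSum_eq_eval (m : ℕ) (p : ℝ) (φ : ℕ → ℝ) :
    binomialSum m p φ
      = ∑ d ∈ Finset.range (m + 1), φ d * (bernsteinPolynomial ℝ m d).eval p := by
  refine Finset.sum_congr rfl fun d _ => ?_
  simp [bernsteinPolynomial]
  ring

lemma binomialSum_add (m : ℕ) (p : ℝ) (φ ψ : ℕ → ℝ) :
    binomialSum m p (fun d => φ d + ψ d) = binomialSum m p φ + binomialSum m p ψ := by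
  simp only [binomialSum, mul_add, Finset.sum_add_distrib]

lemma binomialSum_const_mul (m : ℕ) (p c : ℝ) (φ : ℕ → ℝ) :
    binomialSum m p (fun d => c * φ d) = c * binomialSum m p φ := by
  rw [binomialSum, binomialSum, Finset.mul_sum]
  exact Finset.sum_congr rfl fun d _ => by ring

lemma binomialSum_const (m : ℕ) (p c : ℝ) : binomialSum m p (fun _ => c) = c := by
  have := congrArg (Polynomial.eval p) (bernsteinPolynomial.sum ℝ m)
  rw [Polynomial.eval_finsetSum] at this
  rw [binomialSum_eq_eval, ← Finset.mul_sum, this]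
  simp

lemma binomialSum_id (m : ℕ) (p : ℝ) : binomialSum m p (fun d => d) = m * p := by
  have := congrArg (Polynomial.eval p) (bernsteinPolynomial.sum_smul ℝ m)
  rw [Polynomial.eval_finsetSum] at this
  rw [binomialSum_eq_eval]
  simpa using this

lemma binomialSum_variance (m : ℕ) (p : ℝ) :
    binomialSum m p (fun d => ((d : ℝ) - m * p) ^ 2) = m * p * (1 - p) := by
  have := congrArg (Polynomial.eval p) (bernsteinPolynomial.variance ℝ m)
  rw [Polynomial.eval_finsetSum] at this
  rw [binomialSum_eq_eval]
  simp only [Polynomial.eval_mul, Polynomial.eval_pow, Polynomial.eval_sub,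
    Polynomial.eval_X, Polynomial.eval_natCast, Polynomial.eval_one, nsmul_eq_mul] at this
  rw [← this]
  refine Finset.sum_congr rfl fun d _ => ?_
  ring

lemma binomialSum_sq (m : ℕ) (p : ℝ) :
    binomialSum m p (fun d => (d : ℝ) ^ 2) = m * p * (1 - p) + (m * p) ^ 2 := by
  have h : (fun d : ℕ => (d : ℝ) ^ 2)
      = fun d : ℕ => (((d : ℝ) - m * p) ^ 2 + (2 * (m * p)) * (d : ℝ)) + -(m * p) ^ 2 := by
    ext d
    ring
  rw [h, binomialSum_add, binomialSum_add, binomialSum_const_mul, binomialSum_const, binomialSum_id,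
    binomialSum_variance]
  ring

lemma binomialSum_weight_nonneg {p : ℝ} (h0 : 0 ≤ p) (h1 : p ≤ 1) (m d : ℕ) :
    0 ≤ (m.choose d : ℝ) * p ^ d * (1 - p) ^ (m - d) :=
  mul_nonneg (by positivity) (pow_nonneg (by linarith) _)

lemma binomialSum_mono {m : ℕ} {p : ℝ} (h0 : 0 ≤ p) (h1 : p ≤ 1) {φ ψ : ℕ → ℝ}
    (h : ∀ d ≤ m, φ d ≤ ψ d) : binomialSum m p φ ≤ binomialSum m p ψ :=
  Finset.sum_le_sum fun d hd => mul_le_mul_of_nonneg_left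
    (h d (Nat.lt_succ_iff.1 (Finset.mem_range.1 hd))) (binomialSum_weight_nonneg h0 h1 m d)

lemma binomialSum_nonneg {m : ℕ} {p : ℝ} (h0 : 0 ≤ p) (h1 : p ≤ 1) {φ : ℕ → ℝ}
    (h : ∀ d ≤ m, 0 ≤ φ d) : 0 ≤ binomialSum m p φ := by
  simpa [binomialSum_const] using binomialSum_mono h0 h1 (φ := fun _ => 0) h

/-! ### Hit counts, uniform indices and multiplicities -/

open scoped Classical in
/-- The number of samples in `A`. -/
noncomputable def hitCount {α : Type*} {m : ℕ} (A : Set α) (s : Fin m → α) : ℕ :=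
  ∑ i, if s i ∈ A then 1 else 0

lemma hitCount_le {α : Type*} {m : ℕ} (A : Set α) (s : Fin m → α) : hitCount A s ≤ m := by
  classical
  calc hitCount A s ≤ ∑ _i : Fin m, 1 := Finset.sum_le_sum fun i _ => by split_ifs <;> simp
    _ = m := by simp

open scoped Classical in
lemma hitCount_cons {α : Type*} {m : ℕ} (A : Set α) (z : α) (s : Fin m → α) :
    hitCount A (Fin.cons z s : Fin (m + 1) → α) = (if z ∈ A then 1 else 0) + hitCount A s := by
  rw [hitCount, Fin.sum_univ_succ]
  simp [hitCount]

lemma hitCount_mono {α β : Type*} {m : ℕ} {A : Set α} {A' : Set β} {s : Fin m → α}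
    {s' : Fin m → β} (h : ∀ i, s i ∈ A → s' i ∈ A') : hitCount A s ≤ hitCount A' s' := by
  classical
  refine Finset.sum_le_sum fun i _ => ?_
  by_cases hi : s i ∈ A
  · simp [hi, h i hi]
  · simp [hi]

lemma abs_comp_le_sum_abs {m : ℕ} (φ : ℕ → ℝ) {d : ℕ} (hd : d ≤ m) :
    |φ d| ≤ ∑ d ∈ Finset.range (m + 1), |φ d| :=
  Finset.single_le_sum (f := fun d => |φ d|) (fun _ _ => abs_nonneg _)
    (Finset.mem_range.2 (Nat.lt_succ_of_le hd))

lemma integral_iid_hitCount {α : Type*} [MeasurableSpace α] [Countable α]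
    [MeasurableSingletonClass α] (P : Measure α) [IsProbabilityMeasure P] (A : Set α) :
    ∀ (m : ℕ) (φ : ℕ → ℝ),
      ∫ s, φ (hitCount A s) ∂iidMeasure P m = binomialSum m (P.real A) φ := by
  classical
  intro m
  induction m with
  | zero =>
    intro φ
    simp [binomialSum, hitCount]
  | succ m ih =>
    intro φ
    rw [integral_iid_succ fun s => abs_comp_le_sum_abs φ (hitCount_le A s), binomialSum_succ]
    have e : ∀ z, ∫ s, φ (hitCount A (Fin.cons z s : Fin (m + 1) → α)) ∂iidMeasure P m
        = binomialSum m (P.real A) φ + A.indicator (fun _ => (1 : ℝ)) z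
          * (binomialSum m (P.real A) (fun d => φ (d + 1)) - binomialSum m (P.real A) φ) := by
      intro z
      simp only [hitCount_cons]
      by_cases hz : z ∈ A
      · simp only [hz, if_true, Set.indicator_of_mem, add_comm 1]
        rw [ih fun d => φ (d + 1)]
        ring
      · simp only [hz, if_false, zero_add]
        rw [ih]
        simp [hz]
    simp only [e]
    rw [integral_add (integrable_const _)
      ((integrable_of_bdd (abs_indicator_one_le A)).mul_const _), integral_mul_const,
      ← real_eq_integral_indicator]
    simp
    ring

/-- The uniform law on `Fin m`. -/
noncomputable def unif (m : ℕ) : Measure (Fin m) := (m : ENNReal)⁻¹ • Measure.count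

lemma isProbabilityMeasure_unif {m : ℕ} (hm : 0 < m) : IsProbabilityMeasure (unif m) := by
  refine ⟨?_⟩
  have : (m : ENNReal) ≠ 0 := by exact_mod_cast hm.ne'
  simp [unif, Measure.count_apply, ENNReal.inv_mul_cancel this]

lemma integral_unif {m : ℕ} {E : Type*} [NormedAddCommGroup E] [NormedSpace ℝ E]
    [CompleteSpace E] (g : Fin m → E) : ∫ i, g i ∂unif m = (m : ℝ)⁻¹ • ∑ i, g i := by
  rw [unif, integral_smul_measure, integral_count]
  simp

lemma unif_real {m : ℕ} (A : Set (Fin m)) :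
    (unif m).real A = (hitCount A (id : Fin m → Fin m) : ℝ) / m := by
  classical
  rw [real_eq_integral_indicator, integral_unif]
  simp [hitCount, Set.indicator_apply, div_eq_inv_mul]

/-- The number of occurrences of `y` in `s`. -/
noncomputable abbrev letterCount {α : Type*} {m : ℕ} (s : Fin m → α) (y : α) : ℕ :=
  weightedCount (fun _ => 1) s y

lemma letterCount_eq_hitCount {α : Type*} {m : ℕ} (s : Fin m → α) (y : α) :
    letterCount s y = hitCount {y} s := rfl

lemma letterCount_comp_eq_hitCount {α : Type*} {m n : ℕ} (D : Fin m → α) (I : Fin n → Fin m)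
    (y : α) : letterCount (D ∘ I) y = hitCount {i | D i = y} I := rfl

lemma hitCount_id_eq_letterCount {α : Type*} {m : ℕ} (D : Fin m → α) (y : α) :
    hitCount {i | D i = y} (id : Fin m → Fin m) = letterCount D y := rfl

/-- This allows conditioning on the indices first: for fixed `I`, the dataset is still i.i.d. and
each of its positions is weighted by its multiplicity in `I`. -/
lemma letterCount_comp {α : Type*} {m n : ℕ} (D : Fin m → α) (I : Fin n → Fin m) (y : α) :
    letterCount (D ∘ I) y = weightedCount (letterCount I) D y := by
  classical
  simp only [letterCount, weightedCount, Function.comp_apply, ← Finset.sum_filter]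
  rw [Finset.sum_comm' (t' := Finset.univ) (s' := fun j => {i | D i = y ∧ I j = i})]
  · rw [Finset.sum_filter]
    refine Finset.sum_congr rfl fun j _ => ?_
    by_cases h : D (I j) = y
    · rw [if_pos h, Finset.sum_eq_single (I j)] <;> simp +contextual [h, eq_comm]
    · rw [if_neg h, Finset.sum_eq_zero]
      intro i hi
      simp only [Finset.mem_filter, Finset.mem_univ, true_and] at hi
      exact absurd (hi.2 ▸ hi.1) h
  · intro i j
    simp

lemma sum_letterCount {m n : ℕ} (I : Fin n → Fin m) : ∑ i, letterCount I i = n := by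
  classical
  simp only [letterCount, weightedCount]
  rw [Finset.sum_comm]
  simp

/-- The sum of squares counts pairs of draws with equal index: `n` diagonal pairs, and the others
agree with probability `1 / m`. After division by `n ^ 2`, this is the origin of `1 / n + 1 / m`. -/
lemma integral_sum_letterCount_sq_le {m n : ℕ} (hm : 0 < m) :
    ∫ I, (∑ i, (letterCount I i : ℝ) ^ 2) ∂iidMeasure (unif m) n ≤ n + n ^ 2 / m := by
  have := isProbabilityMeasure_unif hm
  have hm' : (0 : ℝ) < m := by exact_mod_cast hm
  rw [integral_finsetSum _ fun i _ => integrable_of_bdd (C := (n : ℝ) ^ 2) fun I => by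
    rw [abs_of_nonneg (by positivity)]
    have := hitCount_le {i} I
    rw [letterCount_eq_hitCount]
    gcongr]
  have e : ∀ i : Fin m, ∫ I, (letterCount I i : ℝ) ^ 2 ∂iidMeasure (unif m) n
      = n * (m : ℝ)⁻¹ * (1 - (m : ℝ)⁻¹) + (n * (m : ℝ)⁻¹) ^ 2 := by
    intro i
    simp only [letterCount_eq_hitCount]
    rw [integral_iid_hitCount (unif m) {i} n fun d => (d : ℝ) ^ 2, binomialSum_sq]
    have : (unif m).real {i} = (m : ℝ)⁻¹ := by
      rw [unif_real]
      simp [hitCount]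
    rw [this]
  simp only [e, Finset.sum_const, Finset.card_univ, Fintype.card_fin, nsmul_eq_mul]
  have : (m : ℝ) * (n * (m : ℝ)⁻¹ * (1 - (m : ℝ)⁻¹) + (n * (m : ℝ)⁻¹) ^ 2)
      = n + n ^ 2 / m - n * (m : ℝ)⁻¹ := by
    field_simp
    ring
  rw [this]
  have : 0 ≤ (n : ℝ) * (m : ℝ)⁻¹ := by positivity
  linarith

/-! ### Two-stage samples -/

/-- The law of a sample `D` of `P` together with uniform indices `I` into it. -/
noncomputable abbrev twoStage {α : Type*} [MeasurableSpace α] (P : Measure α) (m n : ℕ) :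
    Measure ((Fin m → α) × (Fin n → Fin m)) :=
  (iidMeasure P m).prod (iidMeasure (unif m) n)

section TwoStage

variable {α : Type*} [MeasurableSpace α] [Countable α] [MeasurableSingletonClass α]
  {P : Measure α} [IsProbabilityMeasure P] {m n : ℕ}

lemma twoStage_real (hm : 0 < m) (E : Set ((Fin m → α) × (Fin n → Fin m))) :
    (twoStage P m n).real E
      = ∫ D, (iidMeasure (unif m) n).real {I | (D, I) ∈ E} ∂iidMeasure P m := by
  have := isProbabilityMeasure_unif hm
  rw [real_eq_integral_indicator, integral_prod _ (integrable_of_bdd (abs_indicator_one_le E))]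
  congr 1
  ext D
  rw [real_eq_integral_indicator]
  rfl

lemma twoStage_real_symm (hm : 0 < m) (E : Set ((Fin m → α) × (Fin n → Fin m))) :
    (twoStage P m n).real E
      = ∫ I, (iidMeasure P m).real {D | (D, I) ∈ E} ∂iidMeasure (unif m) n := by
  have := isProbabilityMeasure_unif hm
  rw [real_eq_integral_indicator, integral_prod_symm _ (integrable_of_bdd (abs_indicator_one_le E))]
  congr 1
  ext I
  rw [real_eq_integral_indicator]
  rfl

/-- The probability that `a` is strictly more frequent than `B` in a two-stage sample, when each
letter of `B` is less likely than `a` by at least `τ`. -/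
lemma le_twoStage_real_letterCount_lt (hm : 0 < m) (hn : 0 < n) {a : α} {B : Set α} {τ : ℝ}
    (h0 : 0 < τ) (hτ : τ < P.real {a}) (hB : ∀ y ∈ B, P.real {y} ≤ P.real {a} - τ) :
    (P.real {a} - τ) * (τ / (τ + 4 * (1 / n + 1 / m)))
      ≤ (twoStage P m n).real
        {x | ∀ y ∈ B, letterCount (x.1 ∘ x.2) y < letterCount (x.1 ∘ x.2) a} := by
  have := isProbabilityMeasure_unif hm
  have hn' : (0 : ℝ) < n := by exact_mod_cast hn
  have hm' : (0 : ℝ) < m := by exact_mod_cast hm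
  rw [twoStage_real_symm hm]
  simp only [Set.mem_ofPred_eq, letterCount_comp]
  set ρ : ℝ := 1 / n + 1 / m with hρ
  have hρ0 : 0 < ρ := by positivity
  set A : (Fin n → Fin m) → ℝ := fun I => (∑ i, (letterCount I i : ℝ) ^ 2) / (n : ℝ) ^ 2 with hA
  have hlow : ∀ I : Fin n → Fin m, (P.real {a} - τ) * (τ / (τ + 4 * A I))
      ≤ (iidMeasure P m).real {D | ∀ y ∈ B, weightedCount (letterCount I) D y
        < weightedCount (letterCount I) D a} := by
    intro I
    have hs := sum_letterCount I
    have hs' : ∑ i, (letterCount I i : ℝ) = n := by exact_mod_cast hs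
    have := le_real_weightedCount_lt (letterCount I) (P := P) h0 hτ hB (by omega)
    rwa [hs'] at this
  have hA0 : ∀ I, 0 ≤ A I := fun I => by positivity
  -- Jensen's inequality for `z ↦ 1 / z`, by its tangent `2 c - c² z` at `z = 1 / c`.
  set c : ℝ := (τ + 4 * ρ)⁻¹ with hc
  have hc0 : 0 < c := by positivity
  have htan : ∀ I, (P.real {a} - τ) * (τ * (2 * c - c ^ 2 * (τ + 4 * A I)))
      ≤ (P.real {a} - τ) * (τ / (τ + 4 * A I)) := by
    intro I
    have hp : 0 ≤ P.real {a} - τ := by linarith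
    have hz : 0 < τ + 4 * A I := by linarith [hA0 I]
    rw [div_eq_mul_inv]
    gcongr
    rw [← one_div, le_div_iff₀ hz]
    nlinarith [sq_nonneg (c * (τ + 4 * A I) - 1)]
  have iA : Integrable A (iidMeasure (unif m) n) := Integrable.of_finite
  have hEA : ∫ I, A I ∂iidMeasure (unif m) n ≤ ρ := by
    simp only [hA]
    rw [integral_div]
    have := integral_sum_letterCount_sq_le (n := n) hm
    rw [div_le_iff₀ (by positivity)]
    refine this.trans (le_of_eq ?_)
    rw [hρ]
    field_simp
  calc (P.real {a} - τ) * (τ / (τ + 4 * ρ))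
      = (P.real {a} - τ) * (τ * (2 * c - c ^ 2 * (τ + 4 * ρ))) := by
        rw [hc]
        field_simp
        ring
    _ ≤ (P.real {a} - τ) * (τ * (2 * c - c ^ 2 * (τ + 4 * ∫ I, A I ∂iidMeasure (unif m) n))) := by
        have hp : 0 ≤ P.real {a} - τ := by linarith
        gcongr
    _ = ∫ I, (P.real {a} - τ) * (τ * (2 * c - c ^ 2 * (τ + 4 * A I))) ∂iidMeasure (unif m) n := by
        rw [integral_const_mul, integral_const_mul, integral_sub (by fun_prop) (by fun_prop),
          integral_const_mul (c ^ 2), integral_add (by fun_prop) (by fun_prop),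
          integral_const_mul 4]
        simp
    _ ≤ _ := integral_mono Integrable.of_finite Integrable.of_finite
        fun I => (htan I).trans (hlow I)

end TwoStage

/-! ### Tails of two-stage binomial counts -/

/-- Total positivity of the binomial laws, integrated. -/
lemma binomialSum_mul_le {m : ℕ} {p q : ℝ} (hq : 0 ≤ q) (hqp : q ≤ p) (hp : p ≤ 1) {f g : ℕ → ℝ}
    (h : ∀ d e, e ≤ d → d ≤ m → f e * g d ≤ f d * g e) :
    binomialSum m q f * binomialSum m p g ≤ binomialSum m p f * binomialSum m q g := by
  set bp : ℕ → ℝ := fun d => (m.choose d : ℝ) * p ^ d * (1 - p) ^ (m - d) with hbp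
  set bq : ℕ → ℝ := fun d => (m.choose d : ℝ) * q ^ d * (1 - q) ^ (m - d) with hbq
  -- Monotone likelihood ratio: the binomial weights of `p` gain on those of `q` as the count grows.
  have hcross : ∀ d e, e ≤ d → d ≤ m → bq d * bp e ≤ bp d * bq e := by
    intro d e hed hdm
    obtain ⟨k, rfl⟩ := Nat.exists_eq_add_of_le hed
    have hme : m - e = m - (e + k) + k := by omega
    simp only [hbp, hbq, hme, pow_add]
    have h1 : (q * (1 - p)) ^ k ≤ (p * (1 - q)) ^ k :=
      pow_le_pow_left₀ (mul_nonneg hq (by linarith)) (by nlinarith) k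
    rw [mul_pow, mul_pow] at h1
    have hc : 0 ≤ (m.choose (e + k) : ℝ) * m.choose e * (q ^ e * p ^ e)
        * ((1 - q) ^ (m - (e + k)) * (1 - p) ^ (m - (e + k))) :=
      mul_nonneg (mul_nonneg (by positivity)
        (mul_nonneg (pow_nonneg hq _) (pow_nonneg (hq.trans hqp) _)))
        (mul_nonneg (pow_nonneg (by linarith) _) (pow_nonneg (by linarith) _))
    have := mul_le_mul_of_nonneg_left h1 hc
    calc _ = _ := by ring
      _ ≤ _ := this
      _ = _ := by ring
  have hsum : ∀ b c f g : ℕ → ℝ, (∑ d ∈ Finset.range (m + 1), b d * f d)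
      * (∑ e ∈ Finset.range (m + 1), c e * g e)
      = ∑ d ∈ Finset.range (m + 1), ∑ e ∈ Finset.range (m + 1), b d * f d * (c e * g e) :=
    fun b c f g => Finset.sum_mul_sum _ _ _ _
  -- Both factors are antisymmetric in `d` and `e` and have the same sign; the expanded sum is twice
  -- the wanted difference.
  have hdiff : 0 ≤ ∑ d ∈ Finset.range (m + 1), ∑ e ∈ Finset.range (m + 1),
      (bp d * bq e - bq d * bp e) * (f d * g e - f e * g d) := by
    refine Finset.sum_nonneg fun d hd => Finset.sum_nonneg fun e he => ?_
    have hd' : d ≤ m := Nat.lt_succ_iff.1 (Finset.mem_range.1 hd)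
    have he' : e ≤ m := Nat.lt_succ_iff.1 (Finset.mem_range.1 he)
    rcases le_total e d with hed | hde
    · exact mul_nonneg (sub_nonneg.2 (hcross d e hed hd')) (sub_nonneg.2 (h d e hed hd'))
    · refine mul_nonneg_of_nonpos_of_nonpos ?_ (sub_nonpos.2 (h e d hde he'))
      have := hcross e d hde he'
      linarith
  have hexp : ∑ d ∈ Finset.range (m + 1), ∑ e ∈ Finset.range (m + 1),
      (bp d * bq e - bq d * bp e) * (f d * g e - f e * g d)
      = 2 * (binomialSum m p f * binomialSum m q g)
        - 2 * (binomialSum m q f * binomialSum m p g) := by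
    have e0 : ∀ d e, (bp d * bq e - bq d * bp e) * (f d * g e - f e * g d)
        = bp d * f d * (bq e * g e) - bq d * f d * (bp e * g e)
          - bp d * g d * (bq e * f e) + bq d * g d * (bp e * f e) := fun d e => by ring
    simp only [e0, Finset.sum_add_distrib, Finset.sum_sub_distrib, ← hsum]
    change binomialSum m p f * binomialSum m q g - binomialSum m q f * binomialSum m p g
      - binomialSum m p g * binomialSum m q f + binomialSum m q g * binomialSum m p f = _
    ring
  linarith

/-- The probability that a binomial variable is at least `k`. -/
noncomputable def binomialTail (n : ℕ) (θ : ℝ) (k : ℕ) : ℝ :=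
  binomialSum n θ fun j => if k ≤ j then 1 else 0

/-- The probability that a letter of probability `p` occurs at least `k` times in the second of two
sampling stages. -/
noncomputable def twoStageTail (m n : ℕ) (p : ℝ) (k : ℕ) : ℝ :=
  binomialSum m p fun d => binomialTail n (d / m) k

lemma div_mem_unit {m d : ℕ} (hd : d ≤ m) : 0 ≤ (d : ℝ) / m ∧ (d : ℝ) / m ≤ 1 :=
  ⟨by positivity, div_le_one_of_le₀ (by exact_mod_cast hd) (by positivity)⟩

lemma binomialTail_nonneg {n : ℕ} {θ : ℝ} (h0 : 0 ≤ θ) (h1 : θ ≤ 1) (k : ℕ) :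
    0 ≤ binomialTail n θ k :=
  binomialSum_nonneg h0 h1 fun j _ => by split_ifs <;> simp

lemma binomialTail_le_one {n : ℕ} {θ : ℝ} (h0 : 0 ≤ θ) (h1 : θ ≤ 1) (k : ℕ) :
    binomialTail n θ k ≤ 1 :=
  (binomialSum_mono h0 h1 (ψ := fun _ => 1) fun j _ => by split_ifs <;> simp).trans
    (binomialSum_const n θ 1).le

lemma binomialTail_mul_le {n : ℕ} {p q : ℝ} (hq : 0 ≤ q) (hqp : q ≤ p) (hp : p ≤ 1) {k₀ k : ℕ}
    (hk : k₀ ≤ k) : binomialTail n q k * binomialTail n p k₀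
      ≤ binomialTail n p k * binomialTail n q k₀ := by
  refine binomialSum_mul_le hq hqp hp fun d e hed _ => ?_
  split_ifs <;> first | (exfalso; omega) | simp

/-- Total positivity survives composition: the second-stage tails are themselves totally positive in
the first-stage count. -/
lemma twoStageTail_mul_le {m n : ℕ} {p q : ℝ} (hq : 0 ≤ q) (hqp : q ≤ p) (hp : p ≤ 1) {k₀ k : ℕ}
    (hk : k₀ ≤ k) : twoStageTail m n q k * twoStageTail m n p k₀
      ≤ twoStageTail m n p k * twoStageTail m n q k₀ := by
  refine binomialSum_mul_le hq hqp hp fun d e hed hd => ?_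
  refine binomialTail_mul_le (by positivity) ?_ (div_mem_unit hd).2 hk
  gcongr

lemma binomialSum_sq_dev (n : ℕ) (hn : 0 < n) (θ p : ℝ) :
    binomialSum n θ (fun j => ((j : ℝ) / n - p) ^ 2) = θ * (1 - θ) / n + (θ - p) ^ 2 := by
  have hn' : (n : ℝ) ≠ 0 := by exact_mod_cast hn.ne'
  have h : (fun j : ℕ => ((j : ℝ) / n - p) ^ 2) = fun j : ℕ =>
      (1 / (n : ℝ) ^ 2 * ((j : ℝ) - n * θ) ^ 2 + 2 * (θ - p) / n * (j : ℝ))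
        + ((θ - p) ^ 2 - 2 * (θ - p) * θ) := by
    ext j
    field_simp
    ring
  rw [h, binomialSum_add, binomialSum_add, binomialSum_const_mul, binomialSum_const_mul,
    binomialSum_const, binomialSum_id, binomialSum_variance]
  field_simp
  ring

/-- Total variance: the second stage contributes at most `p / n`, the first at most `p / m`. Keeping
the factor `p` makes the Chebyshev bounds for rare letters proportional to their probability. -/
lemma twoStage_sq_dev_le {m n : ℕ} (hm : 0 < m) (hn : 0 < n) {p : ℝ} (h0 : 0 ≤ p) (h1 : p ≤ 1) :
    binomialSum m p (fun d => binomialSum n (d / m) fun j => ((j : ℝ) / n - p) ^ 2)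
      ≤ p * (1 / n + 1 / m) := by
  have hn' : (0 : ℝ) < n := by exact_mod_cast hn
  have hm' : (0 : ℝ) < m := by exact_mod_cast hm
  calc _ ≤ binomialSum m p (fun d => 1 / (m * n) * (d : ℝ) + ((d : ℝ) / m - p) ^ 2) := by
        refine binomialSum_mono h0 h1 fun d _ => ?_
        rw [binomialSum_sq_dev n hn]
        gcongr
        calc (d : ℝ) / m * (1 - d / m) / n ≤ (d : ℝ) / m * 1 / n := by
              gcongr
              have : 0 ≤ (d : ℝ) / m := by positivity
              linarith
          _ = 1 / (m * n) * (d : ℝ) := by field_simp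
    _ = p / n + p * (1 - p) / m := by
        rw [binomialSum_add, binomialSum_const_mul, binomialSum_id, binomialSum_sq_dev m hm]
        field_simp
        ring
    _ ≤ _ := by
        have : p * (1 - p) / m ≤ p / m := by
          gcongr
          nlinarith
        rw [mul_add, mul_one_div, mul_one_div]
        linarith

lemma twoStageTail_le {m n : ℕ} (hm : 0 < m) (hn : 0 < n) {q u : ℝ} (h0 : 0 ≤ q) (h1 : q ≤ 1)
    (hu : 0 < u) {k : ℕ} (hk : n * (q + u) ≤ k) :
    twoStageTail m n q k ≤ q * (1 / n + 1 / m) / u ^ 2 := by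
  have hn' : (0 : ℝ) < n := by exact_mod_cast hn
  rw [le_div_iff₀ (by positivity), mul_comm]
  refine le_trans ?_ (twoStage_sq_dev_le hm hn h0 h1)
  rw [twoStageTail, ← binomialSum_const_mul]
  refine binomialSum_mono h0 h1 fun d hd => ?_
  rw [binomialTail, ← binomialSum_const_mul]
  refine binomialSum_mono (div_mem_unit hd).1 (div_mem_unit hd).2 fun j _ => ?_
  split_ifs with hkj
  · have : q + u ≤ (j : ℝ) / n := by
      rw [le_div_iff₀ hn', mul_comm]
      exact hk.trans (by exact_mod_cast hkj)
    rw [mul_one]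
    gcongr
    linarith
  · rw [mul_zero]
    exact sq_nonneg _

lemma le_twoStageTail {m n : ℕ} (hm : 0 < m) (hn : 0 < n) {p s : ℝ} (h0 : 0 ≤ p) (h1 : p ≤ 1)
    (hs : 0 < s) {k : ℕ} (hk : k < n * (p - s) + 1) :
    1 - p * (1 / n + 1 / m) / s ^ 2 ≤ twoStageTail m n p k := by
  have hn' : (0 : ℝ) < n := by exact_mod_cast hn
  rw [sub_le_comm, le_div_iff₀ (by positivity), mul_comm]
  refine le_trans ?_ (twoStage_sq_dev_le hm hn h0 h1)
  have e : s ^ 2 * (1 - twoStageTail m n p k) = binomialSum m p fun d =>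
      binomialSum n (d / m) fun j => s ^ 2 * (1 + -1 * if k ≤ j then 1 else 0) := by
    simp only [binomialSum_const_mul, binomialSum_add, binomialSum_const, twoStageTail, binomialTail]
    ring
  rw [e]
  refine binomialSum_mono h0 h1 fun d hd => ?_
  refine binomialSum_mono (div_mem_unit hd).1 (div_mem_unit hd).2 fun j _ => ?_
  split_ifs with hkj
  · have : s ^ 2 * (1 + -1 * 1) = 0 := by ring
    rw [this]
    positivity
  · have : (j : ℝ) / n ≤ p - s := by
      rw [div_le_iff₀ hn', mul_comm]
      have : (j : ℝ) + 1 ≤ k := by exact_mod_cast (not_le.1 hkj)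
      linarith
    norm_num
    nlinarith

lemma binomialTail_eq_real {n : ℕ} {θ : ℝ} (h0 : 0 ≤ θ) (h1 : θ ≤ 1) (k : ℕ) :
    (iidMeasure (bern θ) n).real {s | k ≤ hitCount {true} s} = binomialTail n θ k := by
  have := isProbabilityMeasure_bern h0 h1
  have hb : (bern θ).real {true} = θ := by simp [bern, Measure.real, h0]
  have := integral_iid_hitCount (bern θ) {true} n fun j => if k ≤ j then 1 else 0
  rw [hb] at this
  rw [binomialTail, ← this, real_eq_integral_indicator]
  simp only [Set.indicator_apply, Set.mem_ofPred_eq]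

lemma bern_eq_mix {p q τ : ℝ} (hq0 : 0 ≤ q) (h0 : 0 ≤ τ) (h1 : τ ≤ 1)
    (hp : p = (1 - τ) * q + τ) :
    bern p = ENNReal.ofReal (1 - τ) • bern q + ENNReal.ofReal τ • Measure.dirac true := by
  have e : 1 - p = (1 - τ) * (1 - q) := by rw [hp]; ring
  simp only [bern, smul_add, smul_smul]
  rw [e, ENNReal.ofReal_mul (by linarith), hp,
    ENNReal.ofReal_add (mul_nonneg (by linarith) hq0) h0,
    ENNReal.ofReal_mul (by linarith), add_smul, add_assoc]

/-- Raising the success probability of a binomial law by `ε` makes up for raising the level by one,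
up to the probability that none of the remaining trials is hit. -/
lemma binomialTail_mul_le_succ {n k : ℕ} {θ ε : ℝ} (h0 : 0 ≤ θ) (hε : 0 ≤ ε)
    (h1 : θ + ε ≤ 1) :
    (1 - (1 - ε) ^ (n - k)) * binomialTail n θ k ≤ binomialTail n (θ + ε) (k + 1) := by
  classical
  rcases eq_or_lt_of_le (show θ ≤ 1 by linarith) with hθ | hθ
  · have : ε = 0 := by linarith
    subst this
    simpa using binomialTail_nonneg (n := n) h0 hθ.le (k + 1)
  -- Overwriting failures at rate `τ` raises the success probability from `θ` to exactly `θ + ε`;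
  -- since `τ ≥ ε`, the miss probability `(1 - τ) ^ (n - k)` is at most the stated one.
  set τ := ε / (1 - θ) with hτ
  have hθ' : 0 < 1 - θ := by linarith
  have hτ0 : 0 ≤ τ := by positivity
  have hτ1 : τ ≤ 1 := by rw [hτ, div_le_one hθ']; linarith
  have hετ : ε ≤ τ := by
    rw [hτ, le_div_iff₀ hθ']
    nlinarith
  have hmix := bern_eq_mix (p := θ + ε) h0 hτ0 hτ1 (by rw [hτ]; field_simp; ring)
  have i1 := isProbabilityMeasure_bern h0 hθ.le
  have i2 := isProbabilityMeasure_bern (τ := θ + ε) (by linarith) h1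
  have i3 := isProbabilityMeasure_bern hτ0 hτ1
  rw [← binomialTail_eq_real h0 hθ.le, ← binomialTail_eq_real (by linarith) h1]
  refine mul_real_iid_le_of_mix hτ0 hτ1 hmix fun s hs => ?_
  have grow : ∀ e, hitCount {true} s ≤ hitCount {true} (overwrite true e s) := fun e =>
    hitCount_mono fun i hi => by
      have hi' : s i = true := hi
      simp [overwrite, hi']
  have hpow : 0 ≤ (1 - ε) ^ (n - k) := pow_nonneg (by linarith) _
  by_cases hk : k + 1 ≤ hitCount {true} s
  · have : {e | overwrite true e s ∈ {s : Fin n → Bool | k + 1 ≤ hitCount {true} s}}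
        = Set.univ := Set.eq_univ_of_forall fun e => hk.trans (grow e)
    rw [this, probReal_univ]
    linarith
  -- Only a count of exactly `k` needs help, and it leaves `n - k` failures, any of which may be
  -- hit.
  · have hs' : k ≤ hitCount {true} s := hs
    have hk' : hitCount {true} s = k := by omega
    set H : Finset (Fin n) := {i | s i ≠ true} with hH
    have hcard : H.card = n - k := by
      have h1 : hitCount {true} s + H.card = n := by
        simp only [hitCount, hH, Finset.sum_boole, Set.mem_singleton_iff]
        have := Finset.card_filter_add_card_filter_not (s := (Finset.univ : Finset (Fin n)))
          (fun i => s i = true)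
        simpa using this
      omega
    refine le_trans ?_ (one_sub_pow_le_real_hit hτ0 hτ1 H fun e he => ?_)
    · rw [hcard]
      have : (1 - τ) ^ (n - k) ≤ (1 - ε) ^ (n - k) := pow_le_pow_left₀ (by linarith) (by linarith) _
      linarith
    · obtain ⟨i, hi, hei⟩ := he
      change k + 1 ≤ _
      rw [← hk']
      change weightedCount (fun _ => 1) s true < weightedCount (fun _ => 1) _ true
      refine weightedCount_lt _ (fun j hj => ?_) (i := i) ?_ ?_ one_pos
      · simp [overwrite, hj]
      · simpa [hH] using hi
      · simp [overwrite, hei]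

/-- The Laplace transform of the number of marked positions in `H`, which is binomial. -/
lemma integral_bern_exp_hit {τ x : ℝ} (h0 : 0 ≤ τ) (h1 : τ ≤ 1) {m : ℕ} (H : Finset (Fin m)) :
    ∫ e, (∏ i, if i ∈ H ∧ e i = true then Real.exp (-x) else 1) ∂iidMeasure (bern τ) m
      = (1 - τ * (1 - Real.exp (-x))) ^ H.card := by
  have := isProbabilityMeasure_bern h0 h1
  rw [integral_fintype_prod_eq_prod (μ := fun _ : Fin m => bern τ)
    (fun i (b : Bool) => if i ∈ H ∧ b = true then Real.exp (-x) else 1)]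
  have : ∀ i : Fin m, ∫ b, (if i ∈ H ∧ b = true then Real.exp (-x) else 1) ∂bern τ
      = if i ∈ H then 1 - τ * (1 - Real.exp (-x)) else 1 := by
    intro i
    rw [integral_bern h0 h1 fun b => if i ∈ H ∧ b = true then Real.exp (-x) else 1]
    by_cases hi : i ∈ H <;> simp [hi]
    ring
  rw [Finset.prod_congr rfl fun i _ => this i, Finset.prod_ite]
  simp

lemma exp_neg_le_inv {z : ℝ} (hz : 0 ≤ z) : Real.exp (-z) ≤ 1 / (1 + z) := by
  rw [Real.exp_neg, ← one_div]
  apply one_div_le_one_div_of_le (by linarith)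
  linarith [Real.add_one_le_exp z]

open scoped Classical in
lemma hitCount_overwrite {m : ℕ} (e s : Fin m → Bool) :
    hitCount {true} (overwrite true e s)
      = hitCount {true} s + ({i | s i ≠ true ∧ e i = true} : Finset (Fin m)).card := by
  rw [hitCount, hitCount, Finset.card_filter, ← Finset.sum_add_distrib]
  refine Finset.sum_congr rfl fun i _ => ?_
  cases h : s i <;> cases h' : e i <;> simp [overwrite, h, h']

/-- The gain from the bonus trials outweighs one unit of level in the second stage. -/
lemma twoStageTail_succ_ge {m n k : ℕ} (hm : 0 < m) (hn : 0 < n) (hk : 2 * k ≤ n) {p q τ : ℝ}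
    (hq0 : 0 ≤ q) (hq : q ≤ 1) (hτ1 : τ ≤ 1) (hτ : 6 * (1 / (n : ℝ) + 1 / m) ≤ τ)
    (hp : p = (1 - τ) * q + τ) :
    3 / 5 * (twoStageTail m n q k - binomialSum m q fun d => if m < 2 * d then 1 else 0)
      ≤ twoStageTail m n p (k + 1) := by
  classical
  have hn' : (0 : ℝ) < n := by exact_mod_cast hn
  have hm' : (0 : ℝ) < m := by exact_mod_cast hm
  have hτ0 : 0 < τ := lt_of_lt_of_le (by positivity) hτ
  have hp0 : 0 ≤ p := by rw [hp]; nlinarith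
  have hp1 : p ≤ 1 := by rw [hp]; nlinarith
  have i1 := isProbabilityMeasure_bern hq0 hq
  have i2 := isProbabilityMeasure_bern hp0 hp1
  have i3 := isProbabilityMeasure_bern hτ0.le hτ1
  have hbq : (bern q).real {true} = q := by simp [bern, Measure.real, hq0]
  have hbp : (bern p).real {true} = p := by simp [bern, Measure.real, hp0]
  have hT : ∀ (k : ℕ) (s : Fin m → Bool), |binomialTail n (hitCount {true} s / m) k| ≤ 1 := by
    intro k s
    obtain ⟨h0, h1⟩ := div_mem_unit (hitCount_le {true} s)
    rw [abs_of_nonneg (binomialTail_nonneg h0 h1 k)]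
    exact binomialTail_le_one h0 h1 k
  have e1 : twoStageTail m n p (k + 1) = ∫ s, ∫ e,
      binomialTail n (hitCount {true} (overwrite true e s) / m) (k + 1)
        ∂iidMeasure (bern τ) m ∂iidMeasure (bern q) m := by
    rw [← integral_iid_mix (P := bern p) hτ0.le hτ1 (bern_eq_mix hq0 hτ0.le hτ1 hp)
      (f := fun s => binomialTail n (hitCount {true} s / m) (k + 1)) (hT (k + 1)),
      integral_iid_hitCount (bern p) {true} m fun d => binomialTail n (d / m) (k + 1), hbp]
    rfl
  have e2 : 3 / 5 * (twoStageTail m n q k - binomialSum m q fun d => if m < 2 * d then 1 else 0)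
      = ∫ s, 3 / 5 * (binomialTail n (hitCount {true} s / m) k
        + -1 * if m < 2 * hitCount {true} s then 1 else 0) ∂iidMeasure (bern q) m := by
    rw [integral_iid_hitCount (bern q) {true} m fun d => 3 / 5 * (binomialTail n (d / m) k
        + -1 * if m < 2 * d then 1 else 0), hbq, binomialSum_const_mul, binomialSum_add,
        binomialSum_const_mul, twoStageTail]
    ring
  rw [e1, e2]
  refine integral_mono (Integrable.of_finite) (Integrable.of_finite) fun s => ?_
  set d := hitCount {true} s with hd
  have hdm : d ≤ m := hitCount_le _ _
  obtain ⟨hθ0, hθ1⟩ := div_mem_unit hdm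
  have hT0 := binomialTail_nonneg (n := n) hθ0 hθ1 k
  have hT1 := binomialTail_le_one (n := n) hθ0 hθ1 k
  have hnn : 0 ≤ ∫ e, binomialTail n (hitCount {true} (overwrite true e s) / m) (k + 1)
      ∂iidMeasure (bern τ) m := integral_nonneg fun e => by
    obtain ⟨h0, h1⟩ := div_mem_unit (hitCount_le {true} (overwrite true e s))
    exact binomialTail_nonneg h0 h1 _
  by_cases hbig : m < 2 * d
  · simp only [hbig, if_true]
    refine le_trans ?_ hnn
    linarith
  simp only [hbig, if_false, mul_zero, add_zero]
  set H : Finset (Fin m) := {i | s i ≠ true} with hH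
  have hHcard : d + H.card = m := by
    simp only [hd, hitCount, hH, Finset.sum_boole, Set.mem_singleton_iff]
    have := Finset.card_filter_add_card_filter_not (s := (Finset.univ : Finset (Fin m)))
      (fun i => s i = true)
    simpa using this
  -- If `b` dataset entries are upgraded, the second-stage success probability grows by `b / m`, and
  -- the remaining `n - k` trials all miss with probability at most `exp (-x b)`. Averaging over `b`
  -- brings in its Laplace transform at `x`.
  set x : ℝ := ((n - k : ℕ) : ℝ) / m with hx
  have hx0 : 0 ≤ x := by positivity
  have hstep : ∀ e : Fin m → Bool,
      (1 - ∏ i, if i ∈ H ∧ e i = true then Real.exp (-x) else 1)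
        * binomialTail n (d / m) k
      ≤ binomialTail n (hitCount {true} (overwrite true e s) / m) (k + 1) := by
    intro e
    set b := ({i | s i ≠ true ∧ e i = true} : Finset (Fin m)).card with hb
    have hov : hitCount {true} (overwrite true e s) = d + b := hitCount_overwrite e s
    have hdb : d + b ≤ m := hov ▸ hitCount_le _ _
    have hle := binomialTail_mul_le_succ (n := n) (k := k) (θ := (d : ℝ) / m) (ε := (b : ℝ) / m)
      hθ0 (by positivity) (by
        rw [← add_div]
        exact_mod_cast (div_mem_unit hdb).2)
    rw [hov]
    push_cast
    rw [add_div]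
    refine le_trans ?_ hle
    gcongr
    rw [Finset.prod_ite]
    have hfil : ({i | i ∈ H ∧ e i = true} : Finset (Fin m)).card = b := by
      rw [hb]
      congr 1
      ext i
      simp [hH]
    simp only [Finset.prod_const, hfil, one_pow, mul_one]
    calc (1 - (b : ℝ) / m) ^ (n - k) ≤ (Real.exp (-((b : ℝ) / m))) ^ (n - k) := by
          have hb1 : (b : ℝ) / m ≤ 1 := (div_mem_unit (by omega)).2
          exact pow_le_pow_left₀ (by linarith) (by linarith [Real.add_one_le_exp (-((b : ℝ) / m))]) _
      _ = Real.exp (-x) ^ b := by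
          rw [← Real.exp_nat_mul, ← Real.exp_nat_mul, hx]
          congr 1
          ring
  have hint := integral_mono (μ := iidMeasure (bern τ) m) Integrable.of_finite
    Integrable.of_finite hstep
  refine le_trans ?_ hint
  rw [integral_mul_const, integral_sub Integrable.of_finite Integrable.of_finite,
    integral_bern_exp_hit hτ0.le hτ1]
  simp only [integral_const, probReal_univ, smul_eq_mul, mul_one]
  gcongr
  have hHm : (m : ℝ) / 2 ≤ H.card := by
    have : m ≤ 2 * H.card := by omega
    have : (m : ℝ) ≤ 2 * H.card := by exact_mod_cast this
    linarith
  have hnk : (n : ℝ) / 2 ≤ ((n - k : ℕ) : ℝ) := by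
    have : n ≤ 2 * (n - k) := by omega
    have : (n : ℝ) ≤ 2 * ((n - k : ℕ) : ℝ) := by exact_mod_cast this
    linarith
  have hgain : (n : ℝ) / (2 * m + n) ≤ 1 - Real.exp (-x) := by
    have h1 := exp_neg_le_inv hx0
    have h2 : (n : ℝ) / (2 * m) ≤ x := by
      rw [hx, div_le_div_iff₀ (by positivity) hm']
      nlinarith
    have h3 : 1 / (1 + x) ≤ 1 / (1 + (n : ℝ) / (2 * m)) := by gcongr
    have h4 : 1 / (1 + (n : ℝ) / (2 * m)) = 1 - n / (2 * m + n) := by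
      field_simp
      ring
    linarith
  have hexp1 : Real.exp (-x) ≤ 1 := Real.exp_le_one_iff.2 (by linarith)
  have hpow : (1 - τ * (1 - Real.exp (-x))) ^ H.card
      ≤ Real.exp (-(H.card * (τ * (1 - Real.exp (-x))))) := by
    have he : 0 < Real.exp (-x) := Real.exp_pos _
    calc _ ≤ (Real.exp (-(τ * (1 - Real.exp (-x))))) ^ H.card := by
          refine pow_le_pow_left₀ (by nlinarith) ?_ _
          linarith [Real.add_one_le_exp (-(τ * (1 - Real.exp (-x))))]
      _ = _ := by
          rw [← Real.exp_nat_mul]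
          congr 1
          ring
  -- The factor `6` in the assumption on `τ` gives an exponent of at least `3/2`; then `exp (-3/2) ≤
  -- 2/5`, whence the factor `3/5`.
  have hz : 3 / 2 ≤ (H.card : ℝ) * (τ * (1 - Real.exp (-x))) := by
    calc (3 : ℝ) / 2 ≤ (m : ℝ) / 2 * ((6 * (1 / (n : ℝ) + 1 / m)) * (n / (2 * m + n))) := by
          have : (m : ℝ) / 2 * ((6 * (1 / (n : ℝ) + 1 / m)) * (n / (2 * m + n)))
              = 3 * (m + n) / (2 * m + n) := by
            field_simp
            ring
          rw [this, le_div_iff₀ (by positivity)]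
          nlinarith
      _ ≤ _ := by gcongr
  have hfin := exp_neg_le_inv (z := (H.card : ℝ) * (τ * (1 - Real.exp (-x)))) (by linarith)
  have : 1 / (1 + (H.card : ℝ) * (τ * (1 - Real.exp (-x)))) ≤ 2 / 5 := by
    rw [div_le_div_iff₀ (by linarith) (by norm_num)]
    linarith
  linarith

/-! ### The most likely letter in a two-stage sample -/

lemma real_iid_mul_le_inter {α : Type*} [MeasurableSpace α] [Countable α]
    [MeasurableSingletonClass α] {P : Measure α} [IsProbabilityMeasure P] {m : ℕ} (A : Set α)
    {E F : Set (Fin m → α)} (hE : ∀ s s', (∀ i, s i ∈ A → s' i ∈ A) → s ∈ E → s' ∈ E)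
    (hF : ∀ s i a, a ∈ A → s i ∉ A → s ∈ F → Function.update s i a ∈ F) :
    (iidMeasure P m).real E * (iidMeasure P m).real F ≤ (iidMeasure P m).real (E ∩ F) := by
  have hmono : ∀ {G : Set (Fin m → α)} {s s' : Fin m → α}, (s ∈ G → s' ∈ G) →
      G.indicator (fun _ => (1 : ℝ)) s ≤ G.indicator (fun _ => (1 : ℝ)) s' := by
    intro G s s' h
    by_cases hs : s ∈ G
    · simp [hs, h hs]
    · simpa [hs] using Set.indicator_nonneg (fun _ _ => zero_le_one) s'
  simp only [real_eq_integral_indicator]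
  refine (integral_iid_mul_le A (C := 1) (abs_indicator_one_le E) (abs_indicator_one_le F)
    (fun s s' h => hmono (hE s s' h)) fun s i a ha hs => hmono (hF s i a ha hs)).trans
    (le_of_eq ?_)
  congr 1
  ext s
  by_cases h1 : s ∈ E <;> by_cases h2 : s ∈ F <;> simp [h1, h2]

lemma unif_real_letter {α : Type*} {m : ℕ} (D : Fin m → α) (y : α) :
    (unif m).real {i | D i = y} = (letterCount D y : ℝ) / m := by
  rw [unif_real, hitCount_id_eq_letterCount]

/-- A letter of small probability is unlikely to fill half of a sample. -/
lemma binomialSum_majority_le {m : ℕ} (hm : 0 < m) {q : ℝ} (h0 : 0 ≤ q) (h1 : q ≤ 1 / 10) :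
    (binomialSum m q fun d => if m < 2 * d then 1 else 0) ≤ 25 / 4 * (q / m) := by
  have hm' : (0 : ℝ) < m := by exact_mod_cast hm
  have h := binomialSum_sq_dev m hm q q
  rw [sub_self, zero_pow two_ne_zero, add_zero] at h
  have h2 : (2 / 5 : ℝ) ^ 2 * (binomialSum m q fun d => if m < 2 * d then 1 else 0)
      ≤ q * (1 - q) / m := by
    rw [← h, ← binomialSum_const_mul]
    refine binomialSum_mono h0 (by linarith) fun d _ => ?_
    split_ifs with hd
    · have : (1 / 2 : ℝ) ≤ d / m := by
        rw [div_le_div_iff₀ two_pos hm']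
        have : (m : ℝ) ≤ 2 * d := by exact_mod_cast hd.le
        linarith
      rw [mul_one]
      gcongr
      linarith
    · rw [mul_zero]
      exact sq_nonneg _
  have h3 : q * (1 - q) / m ≤ q / m := by
    gcongr
    nlinarith
  linarith

/-- The tail of the more likely letter outgrows that of the less likely one. -/
lemma le_twoStageTail_of_lt {m n k : ℕ} (hm : 0 < m) (hn : 0 < n) {p q s u v : ℝ}
    (hv : 1 / (n : ℝ) + 1 / m ≤ v) (hq0 : 0 ≤ q) (hp1 : p ≤ 1) (hs : 0 < s) (hu : 0 < u)
    (hpq : p = q + u + s) (hps : p * v / s ^ 2 ≤ 7 / 25) (hk : n * (q + u) ≤ k)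
    (hF : q / 2 < twoStageTail m n q k) : 9 / 25 * (u ^ 2 / v) ≤ twoStageTail m n p k := by
  have hn' : (0 : ℝ) < n := by exact_mod_cast hn
  have hm' : (0 : ℝ) < m := by exact_mod_cast hm
  set ρ : ℝ := 1 / n + 1 / m with hρ
  have hρ0 : 0 < ρ := by positivity
  have hv0 : 0 < v := hρ0.trans_le hv
  have hp0 : 0 ≤ p := by linarith
  have hFk := twoStageTail_le hm hn hq0 (by linarith) hu hk
  have hqpos : 0 < q := by
    refine lt_of_le_of_ne hq0 fun h => ?_
    rw [← h] at hF hFk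
    simp at hF hFk
    linarith
  -- An intermediate level, `u` above the mean frequency `q` and `s` below the mean frequency `p`:
  -- by Chebyshev, the likelier letter reaches it with probability at least `18/25`, the other one
  -- with probability at most `q ρ / u ^ 2`.
  set k₀ := ⌈(n : ℝ) * (q + u)⌉₊ with hk₀
  have hlo := le_twoStageTail hm hn hp0 hp1 hs (k := k₀) (by
    have : p - s = q + u := by linarith
    rw [this]
    exact Nat.ceil_lt_add_one (by positivity))
  have hhi := twoStageTail_le hm hn hq0 (by linarith) hu (k := k₀) (Nat.le_ceil _)
  have hmlr := twoStageTail_mul_le (m := m) (n := n) hq0 (by linarith : q ≤ p) hp1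
    (Nat.ceil_le.2 hk : k₀ ≤ k)
  have hF1 : 0 ≤ twoStageTail m n p k :=
    binomialSum_nonneg hp0 hp1 fun d hd =>
      binomialTail_nonneg (div_mem_unit hd).1 (div_mem_unit hd).2 k
  have hc1 : p * ρ / s ^ 2 ≤ p * v / s ^ 2 := by gcongr
  -- Total positivity between the levels `k₀` and `k`. Both sides are proportional to `q`, which
  -- cancels, so the bound does not deteriorate for rare letters.
  have h3 : q / 2 * (18 / 25) ≤ twoStageTail m n p k * (q * v / u ^ 2) :=
    calc q / 2 * (18 / 25) ≤ twoStageTail m n q k * twoStageTail m n p k₀ :=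
          mul_le_mul hF.le (by linarith) (by norm_num) (by linarith)
      _ ≤ _ := hmlr
      _ ≤ twoStageTail m n p k * (q * ρ / u ^ 2) := by gcongr
      _ ≤ _ := by gcongr
  rw [← mul_div_assoc (twoStageTail m n p k), le_div_iff₀ (by positivity)] at h3
  rw [← mul_div_assoc, div_le_iff₀ hv0]
  exact le_of_mul_le_mul_left (by linarith : q * (9 / 25 * u ^ 2) ≤ q * (twoStageTail m n p k * v))
    hqpos

/-- The gap `t` is spent in three parts: `t / 5` as the bonus that buys the step from `k` to `k +
1`, `s = 7 t / 20` to keep the mean of `a` above the intermediate level, and at least `9 t / 20` as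
the distance of that level from `q`. -/
lemma sq_div_le_twoStageTail_succ {m n k : ℕ} (hm : 0 < m) (hn : 0 < n) {p t v : ℝ}
    (hv : 1 / (n : ℝ) + 1 / m ≤ v) (ht : 0 < t) (htp : t < p) (hpv : 30 * p * v < t ^ 2)
    (htv : t ^ 2 ≤ 32 / 15 * v)
    (hk : 1 ≤ k → ∃ q, 0 ≤ q ∧ q ≤ p - t ∧ q / 2 < twoStageTail m n q k) :
    t ^ 2 / (32 * v) ≤ twoStageTail m n p (k + 1) := by
  have hn' : (0 : ℝ) < n := by exact_mod_cast hn
  have hm' : (0 : ℝ) < m := by exact_mod_cast hm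
  have hn1 : 0 < 1 / (n : ℝ) := by positivity
  have hm1 : 0 < 1 / (m : ℝ) := by positivity
  have hv0 : 0 < v := by linarith
  have hp0 : 0 < p := ht.trans htp
  have hp1 : p < 2 / 25 := by
    have : p * v < 32 / 450 * v := by linarith
    have := lt_of_mul_lt_mul_right this hv0.le
    linarith
  -- Precisely what makes the bonus `t / 5` exceed `6 v`, as `twoStageTail_succ_ge` requires.
  have hvt : 30 * v < t := by
    have : t * (30 * v) < t * t := by
      have : t * v < p * v := by gcongr
      linarith
    exact lt_of_mul_lt_mul_left this ht.le
  have hpr : p * (1 / n + 1 / m) ≤ p * v := by gcongr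
  have hpvpos : 0 < p * v := by positivity
  set s : ℝ := 7 / 20 * t with hs
  set p₁ : ℝ := (p - t / 5) / (1 - t / 5) with hp₁
  have hτ1 : 0 < 1 - t / 5 := by linarith
  have hpmix : p = (1 - t / 5) * p₁ + t / 5 := by
    rw [hp₁, mul_div_cancel₀ _ hτ1.ne']
    ring
  have hp₁lo : p - t / 5 ≤ p₁ := by
    rw [hp₁, le_div_iff₀ hτ1]
    nlinarith
  have hp₁hi : p₁ ≤ p := by
    rw [hp₁, div_le_iff₀ hτ1]
    nlinarith
  have hp₁0 : 0 ≤ p₁ := by linarith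
  have hs0 : 0 < s := by positivity
  have hs2 : s ^ 2 = 49 / 400 * t ^ 2 := by rw [hs]; ring
  -- At a low level, Chebyshev alone suffices. This case also covers `k = 0`, for which no
  -- competitor `q` is available.
  rcases lt_or_ge (k : ℝ) (n * (p₁ - s)) with hklt | hkge
  · have h1 := le_twoStageTail hm hn hp0.le (by linarith) hs0 (k := k + 1) (by
      push_cast
      have : n * (p₁ - s) ≤ n * (p - s) := by gcongr
      linarith)
    have h2 : p * (1 / n + 1 / m) / s ^ 2 ≤ 7 / 25 := by
      rw [div_le_iff₀ (by positivity), hs2]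
      linarith
    have h3 : t ^ 2 / (32 * v) ≤ 1 / 15 := by
      rw [div_le_iff₀ (by positivity)]
      linarith
    linarith
  obtain ⟨q, hq0, hqp, hF⟩ := hk (by
    have : (0 : ℝ) < n * (p₁ - s) := mul_pos hn' (by linarith)
    have : (0 : ℝ) < k := by linarith
    exact_mod_cast this)
  have hu0 : 9 / 20 * t ≤ p₁ - s - q := by linarith
  -- A letter this rare reaches half of the sample with probability below `q / 2` by Chebyshev, so a
  -- level reached as often as `hF` says is at most `n / 2`.
  have hkn : 2 * k ≤ n := by
    by_contra! hlt
    have hlt' : (n : ℝ) ≤ 2 * k := by exact_mod_cast hlt.le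
    have h1 := twoStageTail_le hm hn hq0 (by linarith) (u := 1 / 2 - q) (by linarith) (k := k)
      (by linarith)
    have h3 : (4 / 25 : ℝ) ≤ (1 / 2 - q) ^ 2 := by
      calc (4 / 25 : ℝ) = (2 / 5) ^ 2 := by norm_num
        _ ≤ _ := by gcongr; linarith
    rw [le_div_iff₀ (by linarith)] at h1
    have h2 : q * (1 / n + 1 / m) ≤ q * (1 / 375) := by gcongr; linarith
    have h4 : twoStageTail m n q k * (4 / 25) ≤ twoStageTail m n q k * (1 / 2 - q) ^ 2 :=
      mul_le_mul_of_nonneg_left h3 (by linarith)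
    linarith
  have hmain := le_twoStageTail_of_lt (p := p₁) (u := p₁ - s - q) hm hn hv hq0 (by linarith) hs0
    (by linarith) (by ring) (by
      rw [div_le_iff₀ (by positivity), hs2]
      have : p₁ * v ≤ p * v := by gcongr
      linarith) (le_trans (le_of_eq (by ring)) hkge) hF
  have hbad := binomialSum_majority_le hm hp₁0 (by linarith)
  have hfin := twoStageTail_succ_ge hm hn hkn hp₁0 (by linarith) (by linarith) (by linarith) hpmix
  have h8 : 9 / 25 * (81 / 400 * (t ^ 2 / v)) ≤ twoStageTail m n p₁ k := by
    refine le_trans ?_ hmain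
    have : 81 / 400 * (t ^ 2 / v) = (9 / 20 * t) ^ 2 / v := by ring
    rw [this]
    gcongr
  have h9 : p₁ / m ≤ 1 / 11250 * (t ^ 2 / v) := by
    rw [← mul_div_assoc, le_div_iff₀ hv0]
    have e1 : p₁ / m ≤ p * v := by
      calc p₁ / m = p₁ * (1 / m) := by ring
        _ ≤ p * v := by
          gcongr
          linarith
    have e2 : p₁ / m * v ≤ p * v * v := by gcongr
    have e3 : p * v * v ≤ p * v * (1 / 375) := by
      gcongr
      linarith
    linarith
  have h10 : t ^ 2 / (32 * v) = 1 / 32 * (t ^ 2 / v) := by field_simp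
  have h11 : 0 < t ^ 2 / v := by positivity
  rw [h10]
  linarith

/-! ### The median level and the association of counts -/

section TwoStageTail

variable {α : Type*} [MeasurableSpace α] [Countable α] [MeasurableSingletonClass α]
  {P : Measure α} [IsProbabilityMeasure P] {m n : ℕ}

lemma twoStage_real_letterCount_ge (hm : 0 < m) (y : α) (k : ℕ) :
    (twoStage P m n).real {x | k ≤ letterCount (x.1 ∘ x.2) y}
      = twoStageTail m n (P.real {y}) k := by
  have := isProbabilityMeasure_unif hm
  rw [twoStage_real hm, twoStageTail,
    ← integral_iid_hitCount P {y} m fun d => binomialTail n (d / m) k]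
  congr 1
  ext D
  rw [← letterCount_eq_hitCount, ← unif_real_letter, binomialTail,
    ← integral_iid_hitCount (unif m) {i | D i = y} n fun j => if k ≤ j then 1 else 0,
    real_eq_integral_indicator]
  simp only [Set.indicator_apply, Set.mem_ofPred_eq, letterCount_comp_eq_hitCount]

/-- Large counts of `a` and small counts of the other letters favour each other. -/
lemma twoStage_real_mul_le (hm : 0 < m) {a : α} {B : Set α} (ha : a ∉ B) (k l : ℕ) :
    (twoStage P m n).real {x | k ≤ letterCount (x.1 ∘ x.2) a}
        * (twoStage P m n).real {x | ∀ y ∈ B, letterCount (x.1 ∘ x.2) y ≤ l}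
      ≤ (twoStage P m n).real {x | k ≤ letterCount (x.1 ∘ x.2) a ∧
        ∀ y ∈ B, letterCount (x.1 ∘ x.2) y ≤ l} := by
  have := isProbabilityMeasure_unif hm
  rw [twoStage_real hm, twoStage_real hm, twoStage_real hm]
  simp only [Set.mem_ofPred_eq, letterCount_comp_eq_hitCount]
  set u : (Fin m → α) → ℝ := fun D =>
    (iidMeasure (unif m) n).real {I | k ≤ hitCount {i | D i = a} I} with hu
  set v : (Fin m → α) → ℝ := fun D =>
    (iidMeasure (unif m) n).real {I | ∀ y ∈ B, hitCount {i | D i = y} I ≤ l} with hv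
  -- The association is applied to both stages: here across datasets, where moving an entry to `a`
  -- raises both conditional probabilities, and below among the indices for a fixed dataset.
  calc _ ≤ ∫ D, u D * v D ∂iidMeasure P m := by
        refine integral_iid_mul_le {a} (C := 1) (fun D => abs_measureReal_le_one _)
          (fun D => abs_measureReal_le_one _) (fun D D' h => measureReal_mono fun I hI => ?_)
          (fun D i z hz hi => measureReal_mono fun I hI y hy => ?_)
        · exact le_trans hI (hitCount_mono fun j hj => h _ hj)
        · refine le_trans (hitCount_mono fun j hj => ?_) (hI y hy)
          have hz' : z = a := hz
          have hj' : Function.update D i z (I j) = y := hj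
          by_cases hij : I j = i
          · rw [hij, Function.update_self] at hj'
            exact absurd (hj'.symm.trans hz' ▸ hy) ha
          · rwa [Function.update_of_ne hij] at hj'
    _ ≤ _ := by
        refine integral_mono (integrable_of_bdd (C := 1 * 1) fun D => ?_)
          (integrable_of_bdd fun D => abs_measureReal_le_one _) fun D => ?_
        · rw [abs_mul]
          exact mul_le_mul (abs_measureReal_le_one _) (abs_measureReal_le_one _) (abs_nonneg _)
            zero_le_one
        · simp only [hu, hv]
          refine real_iid_mul_le_inter {i | D i = a}
            (E := {I | k ≤ hitCount {i | D i = a} I})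
            (F := {I | ∀ y ∈ B, hitCount {i | D i = y} I ≤ l})
            (fun I I' h hI => le_trans hI (hitCount_mono h)) fun I j i hi hj hI y hy => ?_
          refine le_trans (hitCount_mono fun j' hj' => ?_) (hI y hy)
          have hi' : D i = a := hi
          have hj'' : D (Function.update I j i j') = y := hj'
          by_cases h : j' = j
          · rw [h, Function.update_self] at hj''
            exact absurd (hj''.symm.trans hi' ▸ hy) ha
          · rwa [Function.update_of_ne h] at hj''

/-- A level that is unlikely to be exceeded and, unless trivial, likely to be reached, by a letter
of `B`. -/
lemma exists_twoStage_level (hm : 0 < m) (B : Set α) :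
    ∃ k : ℕ, 1 / 2 ≤ (twoStage P m n).real {x | ∀ y ∈ B, letterCount (x.1 ∘ x.2) y ≤ k} ∧
      (1 ≤ k → ∃ y ∈ B, P.real {y} / 2 < twoStageTail m n (P.real {y}) k) := by
  classical
  have := isProbabilityMeasure_unif hm
  have hex : ∃ k : ℕ,
      1 / 2 ≤ (twoStage P m n).real {x | ∀ y ∈ B, letterCount (x.1 ∘ x.2) y ≤ k} := by
    refine ⟨n, ?_⟩
    have : {x : (Fin m → α) × (Fin n → Fin m) | ∀ y ∈ B, letterCount (x.1 ∘ x.2) y ≤ n}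
        = Set.univ := Set.eq_univ_of_forall fun x y _ => hitCount_le {y} _
    rw [this, probReal_univ]
    norm_num
  refine ⟨Nat.find hex, Nat.find_spec hex, fun hk => ?_⟩
  set k := Nat.find hex with hkdef
  -- Minimality: with probability above `1/2`, some letter of `B` occurs at least `k` times. If each
  -- tail were at most half the letter's probability, the union bound would give at most `P B / 2 ≤
  -- 1/2`.
  have hmin := Nat.find_min hex (m := k - 1) (by omega)
  by_contra! hcon
  apply hmin
  set E := {x : (Fin m → α) × (Fin n → Fin m) | ∀ y ∈ B, letterCount (x.1 ∘ x.2) y ≤ k - 1} with hE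
  have hcov : Eᶜ ⊆ ⋃ y ∈ B, {x | k ≤ letterCount (x.1 ∘ x.2) y} := by
    intro x hx
    simp only [hE, Set.mem_compl_iff, Set.mem_ofPred_eq, not_forall, not_le] at hx
    obtain ⟨y, hy, hlt⟩ := hx
    simp only [Set.mem_iUnion]
    exact ⟨y, hy, by change k ≤ _; omega⟩
  have h1 : twoStage P m n Eᶜ ≤ ENNReal.ofReal (1 / 2) := by
    calc twoStage P m n Eᶜ ≤ ∑' y : B, twoStage P m n {x | k ≤ letterCount (x.1 ∘ x.2) (y : α)} :=
          (measure_mono hcov).trans (measure_biUnion_le _ (Set.to_countable B) _)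
      _ ≤ ∑' y : B, ENNReal.ofReal (1 / 2) * P {(y : α)} := by
          refine ENNReal.tsum_le_tsum fun y => ?_
          have := hcon y y.2
          rw [← twoStage_real_letterCount_ge hm] at this
          rw [← ofReal_measureReal, ← ofReal_measureReal (μ := P), ← ENNReal.ofReal_mul (by norm_num)]
          exact ENNReal.ofReal_le_ofReal (by linarith)
      _ = ENNReal.ofReal (1 / 2) * P B := by
          rw [ENNReal.tsum_mul_left, tsum_measure_singleton_subtype]
      _ ≤ ENNReal.ofReal (1 / 2) * 1 := by
          gcongr
          exact prob_le_one
      _ = _ := mul_one _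
  have h2 : (twoStage P m n).real Eᶜ ≤ 1 / 2 := ENNReal.toReal_le_of_le_ofReal (by norm_num) h1
  rw [probReal_compl_eq_one_sub (Set.to_countable _).measurableSet] at h2
  linarith

/-- The probability that `a` is strictly more frequent than `B` in a two-stage sample, when each
letter of `B` is much less likely than `a`. -/
lemma sq_div_le_twoStage_real_letterCount_lt (hm : 0 < m) (hn : 0 < n) {a : α} {B : Set α}
    {t v : ℝ} (hv : 1 / (n : ℝ) + 1 / m ≤ v) (ht : 0 < t) (htp : t < P.real {a})
    (hB : ∀ y ∈ B, P.real {y} ≤ P.real {a} - t) (hpv : 30 * P.real {a} * v < t ^ 2)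
    (htv : t ^ 2 ≤ 32 / 15 * v) :
    t ^ 2 / (64 * v) ≤ (twoStage P m n).real
        {x | ∀ y ∈ B, letterCount (x.1 ∘ x.2) y < letterCount (x.1 ∘ x.2) a} := by
  have := isProbabilityMeasure_unif hm
  have ha : a ∉ B := fun h => by linarith [hB a h]
  obtain ⟨k, hk, hky⟩ := exists_twoStage_level (P := P) (n := n) hm B
  have h : t ^ 2 / (32 * v) ≤ twoStageTail m n (P.real {a}) (k + 1) :=
    sq_div_le_twoStageTail_succ hm hn hv ht htp hpv htv fun h => by
      obtain ⟨y, hy, hF⟩ := hky h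
      exact ⟨_, measureReal_nonneg, hB y hy, hF⟩
  have hv0 : 0 < v := lt_of_lt_of_le (by
    have hn' : (0 : ℝ) < n := by exact_mod_cast hn
    positivity) hv
  -- `a` reaches `k + 1` while all of `B` stays at or below `k`; the latter has probability at least
  -- `1/2`, hence the loss from `32` to `64`.
  have hneg := twoStage_real_mul_le (P := P) (n := n) hm ha (k + 1) k
  rw [twoStage_real_letterCount_ge hm] at hneg
  have hnn : 0 ≤ twoStageTail m n (P.real {a}) (k + 1) := le_trans (by positivity) h
  calc t ^ 2 / (64 * v) = t ^ 2 / (32 * v) * (1 / 2) := by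
        field_simp
        norm_num
    _ ≤ twoStageTail m n (P.real {a}) (k + 1) * (1 / 2) := by gcongr
    _ ≤ _ := mul_le_mul_of_nonneg_left hk hnn
    _ ≤ _ := hneg
    _ ≤ _ := measureReal_mono fun x hx y hy => (hx.2 y hy).trans_lt hx.1

end TwoStageTail

/-! ### Concentration of empirical means in a Hilbert space -/

section BoundedDifferences

variable {α : Type*} [MeasurableSpace α] [Countable α] [MeasurableSingletonClass α]
  {P : Measure α} [IsProbabilityMeasure P]

/-- Hoeffding's lemma for a function of oscillation at most `c`. -/
lemma integral_exp_le_of_osc {G : α → ℝ} {C c h : ℝ} (hG : ∀ z, |G z| ≤ C) (hc : 0 ≤ c)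
    (hosc : ∀ z z', G z ≤ G z' + c) :
    ∫ z, Real.exp (h * G z) ∂P ≤ Real.exp (h * (∫ z, G z ∂P) + h ^ 2 * c ^ 2 / 8) := by
  have hne : Nonempty α := by
    by_contra hne
    rw [not_nonempty_iff] at hne
    have := probReal_univ (μ := P)
    simp [Set.eq_empty_of_isEmpty] at this
  have hbdd : BddBelow (Set.range G) := ⟨-C, by
    rintro _ ⟨z, rfl⟩
    exact neg_le_of_abs_le (hG z)⟩
  have hmem : ∀ z, G z ∈ Set.Icc (⨅ z, G z) ((⨅ z, G z) + c) := fun z =>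
    ⟨ciInf_le hbdd z, by
      have : G z - c ≤ ⨅ z, G z := le_ciInf fun z' => by linarith [hosc z z']
      linarith⟩
  have hsub := hasSubgaussianMGF_of_mem_Icc (μ := P)
    (Measurable.of_discrete (f := G)).aemeasurable (Filter.Eventually.of_forall hmem)
  have hm := hsub.mgf_le h
  have e1 : mgf (fun z => G z - ∫ z, G z ∂P) P h
      = Real.exp (-(h * ∫ z, G z ∂P)) * ∫ z, Real.exp (h * G z) ∂P := by
    rw [mgf, ← integral_const_mul]
    congr 1
    ext z
    beta_reduce
    rw [← Real.exp_add, mul_sub, sub_eq_add_neg, add_comm]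
  rw [e1] at hm
  rw [Real.exp_add]
  have e2 : Real.exp (h * ∫ z, G z ∂P) * Real.exp (-(h * ∫ z, G z ∂P)) = 1 := by
    rw [← Real.exp_add]
    simp
  calc ∫ z, Real.exp (h * G z) ∂P
      = Real.exp (h * ∫ z, G z ∂P) * (Real.exp (-(h * ∫ z, G z ∂P))
          * ∫ z, Real.exp (h * G z) ∂P) := by rw [← mul_assoc, e2, one_mul]
    _ ≤ _ := by
      refine mul_le_mul_of_nonneg_left (hm.trans (le_of_eq ?_)) (Real.exp_pos _).le
      congr 1
      simp [abs_of_nonneg hc]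
      ring

/-- McDiarmid's inequality, in exponential form. -/
lemma integral_iid_exp_le {C c h : ℝ} (hc : 0 ≤ c) : ∀ {m : ℕ} {g : (Fin m → α) → ℝ},
    (∀ s, |g s| ≤ C) → (∀ s i z, g (Function.update s i z) ≤ g s + c) →
      ∫ s, Real.exp (h * g s) ∂iidMeasure P m
        ≤ Real.exp (h * (∫ s, g s ∂iidMeasure P m) + h ^ 2 * (m * c ^ 2) / 8) := by
  intro m
  induction m with
  | zero =>
    intro g _ _
    simp [integral_iid_zero]
  | succ m ih =>
    intro g hg hosc
    have hexp : ∀ s, |Real.exp (h * g s)| ≤ Real.exp (|h| * C) := fun s => by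
      rw [abs_of_pos (Real.exp_pos _), Real.exp_le_exp]
      calc h * g s ≤ |h * g s| := le_abs_self _
        _ = |h| * |g s| := abs_mul _ _
        _ ≤ |h| * C := by gcongr; exact hg s
    rw [integral_iid_succ hexp, integral_iid_succ hg]
    set G : α → ℝ := fun z => ∫ s, g (Fin.cons z s) ∂iidMeasure P m with hGdef
    have hG : ∀ z, |G z| ≤ C := fun z => abs_integral_le_of_bdd fun s => hg _
    have hGosc : ∀ z z', G z ≤ G z' + c := fun z z' => by
      have h1 : G z ≤ ∫ s, (g (Fin.cons z' s) + c) ∂iidMeasure P m := by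
        refine integral_mono (integrable_of_bdd fun s => hg _)
          ((integrable_of_bdd fun s => hg _).add (integrable_const c)) fun s => ?_
        have := hosc (Fin.cons z' s) 0 z
        rwa [Fin.update_cons_zero] at this
      rw [integral_add (integrable_of_bdd fun s => hg _) (integrable_const c)] at h1
      simpa using h1
    have hstep : ∀ z, ∫ s, Real.exp (h * g (Fin.cons z s)) ∂iidMeasure P m
        ≤ Real.exp (h * G z) * Real.exp (h ^ 2 * (m * c ^ 2) / 8) := fun z => by
      rw [← Real.exp_add]
      refine ih (fun s => hg _) fun s i z' => ?_
      have := hosc (Fin.cons z s) i.succ z'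
      rwa [← Fin.cons_update] at this
    have hexpG : ∀ z, |Real.exp (h * G z)| ≤ Real.exp (|h| * C) := fun z => by
      rw [abs_of_pos (Real.exp_pos _), Real.exp_le_exp]
      calc h * G z ≤ |h * G z| := le_abs_self _
        _ = |h| * |G z| := abs_mul _ _
        _ ≤ |h| * C := by gcongr; exact hG z
    calc _ ≤ ∫ z, Real.exp (h * G z) * Real.exp (h ^ 2 * (m * c ^ 2) / 8) ∂P :=
          integral_mono (integrable_of_bdd (C := Real.exp (|h| * C)) fun z =>
            abs_integral_le_of_bdd fun s => hexp _)
            ((integrable_of_bdd hexpG).mul_const _) hstep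
      _ = (∫ z, Real.exp (h * G z) ∂P) * Real.exp (h ^ 2 * (m * c ^ 2) / 8) :=
          integral_mul_const _ _
      _ ≤ Real.exp (h * (∫ z, G z ∂P) + h ^ 2 * c ^ 2 / 8)
            * Real.exp (h ^ 2 * (m * c ^ 2) / 8) := by
          gcongr
          exact integral_exp_le_of_osc hG hc hGosc
      _ = _ := by
          rw [← Real.exp_add]
          congr 1
          push_cast
          ring

/-- McDiarmid's inequality for differences of size `2 / m`. -/
lemma real_iid_add_le_le_exp {C : ℝ} {m : ℕ} (hm : 0 < m) {g : (Fin m → α) → ℝ}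
    (hg : ∀ s, |g s| ≤ C) (hosc : ∀ s i z, g (Function.update s i z) ≤ g s + 2 / m)
    {x : ℝ} (hx : 0 ≤ x) :
    (iidMeasure P m).real {s | (∫ s, g s ∂iidMeasure P m) + x / √m ≤ g s}
      ≤ Real.exp (-(x ^ 2 / 2)) := by
  have hm' : (0 : ℝ) < m := by exact_mod_cast hm
  set E := ∫ s, g s ∂iidMeasure P m with hE
  -- The minimiser of the Chernoff exponent `h² / (2 m) - h x / √m`.
  set h : ℝ := x * √m with hh
  have hsq : √(m : ℝ) ^ 2 = m := Real.sq_sqrt hm'.le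
  have hpos : 0 < √(m : ℝ) := Real.sqrt_pos.2 hm'
  have hexp : ∀ s, |Real.exp (h * g s)| ≤ Real.exp (|h| * C) := fun s => by
    rw [abs_of_pos (Real.exp_pos _), Real.exp_le_exp]
    calc h * g s ≤ |h * g s| := le_abs_self _
      _ = |h| * |g s| := abs_mul _ _
      _ ≤ |h| * C := by gcongr; exact hg s
  have hmc := integral_iid_exp_le (P := P) (h := h) (by positivity : (0 : ℝ) ≤ 2 / m) hg hosc
  rw [real_eq_integral_indicator]
  calc _ ≤ ∫ s, Real.exp (-(h * (E + x / √m))) * Real.exp (h * g s) ∂iidMeasure P m := by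
        refine integral_mono (integrable_of_bdd (abs_indicator_one_le _))
          ((integrable_of_bdd hexp).const_mul _) fun s => ?_
        change Set.indicator _ _ s ≤ _
        rw [← Real.exp_add]
        refine Set.indicator_apply_le' (fun hs => ?_) fun _ => (Real.exp_pos _).le
        rw [Real.one_le_exp_iff]
        have : h * (E + x / √m) ≤ h * g s := by
          gcongr
          exact hs
        linarith
    _ = Real.exp (-(h * (E + x / √m))) * ∫ s, Real.exp (h * g s) ∂iidMeasure P m :=
        integral_const_mul _ _
    _ ≤ Real.exp (-(h * (E + x / √m))) * Real.exp (h * E + h ^ 2 * (m * (2 / m) ^ 2) / 8) := by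
        gcongr
    _ = _ := by
        rw [← Real.exp_add]
        congr 1
        have e1 : h * (x / √m) = x ^ 2 := by rw [hh]; field_simp
        have e2 : h ^ 2 * (m * (2 / m) ^ 2) / 8 = x ^ 2 / 2 := by
          rw [hh, mul_pow, hsq]
          field_simp
          norm_num
        rw [e2, mul_add, e1]
        ring

end BoundedDifferences

/-- The distance of the empirical mean of `e` to its mean. -/
noncomputable def meanDev {α H : Type*} [MeasurableSpace α] [NormedAddCommGroup H]
    [NormedSpace ℝ H] (P : Measure α) (e : α → H) {m : ℕ} (s : Fin m → α) : ℝ :=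
  ‖(m : ℝ)⁻¹ • ∑ i, e (s i) - ∫ z, e z ∂P‖

lemma integrable_of_norm_le_one {α H : Type*} [MeasurableSpace α] [Countable α]
    [MeasurableSingletonClass α] [NormedAddCommGroup H] {P : Measure α} [IsFiniteMeasure P]
    {e : α → H} (he : ∀ z, ‖e z‖ ≤ 1) : Integrable e P :=
  Integrable.of_bound StronglyMeasurable.of_discrete.aestronglyMeasurable 1
    (Filter.Eventually.of_forall he)

lemma norm_integral_le_one {α H : Type*} [MeasurableSpace α] [NormedAddCommGroup H]
    [NormedSpace ℝ H] {P : Measure α} [IsProbabilityMeasure P] {e : α → H}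
    (he : ∀ z, ‖e z‖ ≤ 1) : ‖∫ z, e z ∂P‖ ≤ 1 := by
  simpa using norm_integral_le_of_norm_le_const (μ := P) (f := e) (C := 1)
    (Filter.Eventually.of_forall he)

lemma abs_meanDev_le {α H : Type*} [MeasurableSpace α] [NormedAddCommGroup H]
    [NormedSpace ℝ H] {P : Measure α} [IsProbabilityMeasure P] {e : α → H} (he : ∀ z, ‖e z‖ ≤ 1) {m : ℕ} (s : Fin m → α) : |meanDev P e s| ≤ 2 := by
  rw [meanDev, abs_of_nonneg (norm_nonneg _)]
  refine (norm_sub_le _ _).trans ?_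
  have h1 : ‖(m : ℝ)⁻¹ • ∑ i, e (s i)‖ ≤ 1 := by
    rw [norm_smul, norm_inv, Real.norm_natCast]
    have : ‖∑ i, e (s i)‖ ≤ m := by
      simpa using norm_sum_le_of_le Finset.univ fun i _ => he (s i)
    calc (m : ℝ)⁻¹ * ‖∑ i, e (s i)‖ ≤ (m : ℝ)⁻¹ * m := by gcongr
      _ ≤ 1 := inv_mul_le_one
  linarith [norm_integral_le_one (P := P) he]

section EmpiricalMean

variable {α : Type*} [MeasurableSpace α] [Countable α] [MeasurableSingletonClass α]
  {P : Measure α} [IsProbabilityMeasure P] {H : Type*} [NormedAddCommGroup H]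
  [InnerProductSpace ℝ H] [CompleteSpace H] {e : α → H}

/-- The centred increment is orthogonal to `v` on average, and its variance is at most its second
moment, hence at most `1`. The dimension plays no role. -/
lemma integral_norm_add_sub_sq_le (he : ∀ z, ‖e z‖ ≤ 1) (v : H) :
    ∫ z, ‖v + (e z - ∫ z, e z ∂P)‖ ^ 2 ∂P ≤ ‖v‖ ^ 2 + 1 := by
  set μ := ∫ z, e z ∂P with hμ
  have hie : Integrable e P := integrable_of_norm_le_one he
  have hle : ∀ z, ‖v + (e z - μ)‖ ^ 2 ≤ ‖v - μ‖ ^ 2 + 1 + 2 * inner ℝ (v - μ) (e z) := fun z => by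
    have h1 : v + (e z - μ) = (v - μ) + e z := by abel
    rw [h1, norm_add_sq_real]
    have : ‖e z‖ ^ 2 ≤ 1 := pow_le_one₀ (norm_nonneg _) (he z)
    linarith
  have hI : Integrable (fun z => inner ℝ (v - μ) (e z)) P := hie.const_inner _
  calc _ ≤ ∫ z, (‖v - μ‖ ^ 2 + 1 + 2 * inner ℝ (v - μ) (e z)) ∂P := by
        refine integral_mono (integrable_of_bdd (C := (‖v‖ + 2) ^ 2) fun z => ?_)
          ((integrable_const _).add (hI.const_mul 2)) hle
        rw [abs_of_nonneg (by positivity)]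
        gcongr
        refine (norm_add_le _ _).trans ?_
        gcongr
        refine (norm_sub_le _ _).trans ?_
        linarith [he z, norm_integral_le_one (P := P) he]
    _ = ‖v - μ‖ ^ 2 + 1 + 2 * inner ℝ (v - μ) μ := by
        rw [integral_add (integrable_const _) (hI.const_mul 2), integral_const_mul,
          integral_inner hie]
        simp [hμ]
    _ ≤ _ := by
        have h2 : v = (v - μ) + μ := by abel
        have h3 : ‖v‖ ^ 2 = ‖v - μ‖ ^ 2 + 2 * inner ℝ (v - μ) μ + ‖μ‖ ^ 2 := by
          conv_lhs => rw [h2]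
          exact norm_add_sq_real _ _
        linarith [sq_nonneg ‖μ‖]

lemma integral_iid_norm_add_sum_sq_le (he : ∀ z, ‖e z‖ ≤ 1) : ∀ (m : ℕ) (v : H),
    ∫ s, ‖v + ∑ i, (e (s i) - ∫ z, e z ∂P)‖ ^ 2 ∂iidMeasure P m ≤ ‖v‖ ^ 2 + m := by
  set μ := ∫ z, e z ∂P with hμ
  have hbd : ∀ z, ‖e z - μ‖ ≤ 2 := fun z => (norm_sub_le _ _).trans (by
    linarith [he z, norm_integral_le_one (P := P) he])
  have hB : ∀ (m : ℕ) (v : H) (s : Fin m → α), |‖v + ∑ i, (e (s i) - μ)‖ ^ 2|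
      ≤ (‖v‖ + m * 2) ^ 2 := fun m v s => by
    rw [abs_of_nonneg (by positivity)]
    gcongr
    refine (norm_add_le _ _).trans ?_
    gcongr
    simpa using norm_sum_le_of_le Finset.univ fun i _ => hbd (s i)
  intro m
  induction m with
  | zero =>
    intro v
    rw [integral_iid_zero]
    simp
  | succ m ih =>
    intro v
    rw [integral_iid_succ (hB _ v)]
    simp only [Fin.sum_univ_succ, Fin.cons_zero, Fin.cons_succ, ← add_assoc]
    have hv : ∀ z, ‖v + (e z - μ)‖ ≤ ‖v‖ + 2 := fun z =>
      (norm_add_le _ _).trans (by linarith [hbd z])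
    have hint : Integrable (fun z => ‖v + (e z - μ)‖ ^ 2) P :=
      integrable_of_bdd (C := (‖v‖ + 2) ^ 2) fun z => by
        rw [abs_of_nonneg (by positivity)]
        gcongr
        exact hv z
    calc _ ≤ ∫ z, (‖v + (e z - μ)‖ ^ 2 + m) ∂P := by
          refine integral_mono (integrable_of_bdd (C := (‖v‖ + 2 + m * 2) ^ 2) fun z =>
            abs_integral_le_of_bdd fun s => (hB _ _ _).trans ?_)
            (hint.add (integrable_const _)) fun z => ih _
          gcongr
          exact hv z
      _ = ∫ z, ‖v + (e z - μ)‖ ^ 2 ∂P + m := by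
          rw [integral_add hint (integrable_const _)]
          simp
      _ ≤ _ := by
          push_cast
          linarith [integral_norm_add_sub_sq_le (P := P) he v]

lemma integral_iid_meanDev_sq_le (he : ∀ z, ‖e z‖ ≤ 1) {m : ℕ} (hm : 0 < m) :
    ∫ s, meanDev P e s ^ 2 ∂iidMeasure P m ≤ 1 / m := by
  have hm' : (0 : ℝ) < m := by exact_mod_cast hm
  have h := integral_iid_norm_add_sum_sq_le (P := P) he m 0
  have e1 : ∀ s : Fin m → α, meanDev P e s ^ 2
      = ((m : ℝ)⁻¹) ^ 2 * ‖0 + ∑ i, (e (s i) - ∫ z, e z ∂P)‖ ^ 2 := fun s => by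
    have : (m : ℝ)⁻¹ • ∑ i, e (s i) - ∫ z, e z ∂P
        = (m : ℝ)⁻¹ • (0 + ∑ i, (e (s i) - ∫ z, e z ∂P)) := by
      rw [zero_add, Finset.sum_sub_distrib, smul_sub]
      simp [← Nat.cast_smul_eq_nsmul ℝ, smul_smul, inv_mul_cancel₀ hm'.ne']
    rw [meanDev, this, norm_smul, mul_pow, norm_inv, Real.norm_natCast]
  simp only [e1]
  rw [integral_const_mul]
  calc _ ≤ ((m : ℝ)⁻¹) ^ 2 * (‖(0 : H)‖ ^ 2 + m) := by gcongr
    _ = 1 / m := by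
      rw [norm_zero]
      field_simp
      norm_num

lemma integral_iid_meanDev_le (he : ∀ z, ‖e z‖ ≤ 1) {m : ℕ} (hm : 0 < m) :
    ∫ s, meanDev P e s ∂iidMeasure P m ≤ 1 / √m := by
  have hm' : (0 : ℝ) < m := by exact_mod_cast hm
  have hpos : 0 < √(m : ℝ) := Real.sqrt_pos.2 hm'
  have hsq : √(m : ℝ) ^ 2 = m := Real.sq_sqrt hm'.le
  have hi : Integrable (fun s : Fin m → α => meanDev P e s ^ 2) (iidMeasure P m) :=
    integrable_of_bdd (C := 2 ^ 2) fun s => by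
      rw [abs_pow]
      gcongr
      exact abs_meanDev_le he s
  -- The bound on the mean by the second moment, through the AM–GM inequality with equality at
  -- `meanDev P e s = 1 / √m`.
  have hle : ∀ s : Fin m → α, meanDev P e s ≤ √m / 2 * meanDev P e s ^ 2 + 1 / (2 * √m) := fun s => by
    have := sq_nonneg (√m * meanDev P e s - 1)
    have h2 : 0 ≤ (√m * meanDev P e s - 1) ^ 2 / (2 * √m) := by positivity
    have h3 : (√m * meanDev P e s - 1) ^ 2 / (2 * √m)
        = √m / 2 * meanDev P e s ^ 2 + 1 / (2 * √m) - meanDev P e s := by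
      field_simp
      ring
    linarith
  calc _ ≤ ∫ s, (√m / 2 * meanDev P e s ^ 2 + 1 / (2 * √m)) ∂iidMeasure P m :=
        integral_mono (integrable_of_bdd (abs_meanDev_le he))
          ((hi.const_mul _).add (integrable_const _)) hle
    _ = √m / 2 * ∫ s, meanDev P e s ^ 2 ∂iidMeasure P m + 1 / (2 * √m) := by
        rw [integral_add (hi.const_mul _) (integrable_const _), integral_const_mul]
        simp
    _ ≤ √m / 2 * (1 / m) + 1 / (2 * √m) := by
        gcongr
        exact integral_iid_meanDev_sq_le he hm
    _ = _ := by
        field_simp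
        linarith

lemma real_iid_le_meanDev_le_exp (he : ∀ z, ‖e z‖ ≤ 1) {m : ℕ} (hm : 0 < m) {x : ℝ}
    (hx : 0 ≤ x) :
    (iidMeasure P m).real {s | (1 + x) / √m ≤ meanDev P e s} ≤ Real.exp (-(x ^ 2 / 2)) := by
  refine le_trans (measureReal_mono fun s hs => ?_)
    (real_iid_add_le_le_exp (P := P) hm (abs_meanDev_le he) (fun s i z => ?_) hx)
  · have h1 := integral_iid_meanDev_le (P := P) he hm
    have h2 : (1 + x) / √m ≤ meanDev P e s := hs
    rw [add_div] at h2
    change (_ : ℝ) + _ ≤ _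
    linarith
  · have h1 : ∑ j, e (Function.update s i z j) = ∑ j, e (s j) + (e z - e (s i)) := by
      have : ∀ j, e (Function.update s i z j) = e (s j) + if j = i then e z - e (s i) else 0 := by
        intro j
        by_cases h : j = i
        · rw [h]
          simp
        · simp [h]
      simp [this, Finset.sum_add_distrib]
    rw [meanDev, meanDev, h1, smul_add, add_sub_right_comm]
    refine (norm_add_le _ _).trans ?_
    gcongr
    rw [norm_smul, norm_inv, Real.norm_natCast, inv_mul_eq_div]
    gcongr
    exact (norm_sub_le _ _).trans (by linarith [he z, he (s i)])

end EmpiricalMean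

/-! ### Two-stage empirical distributions -/

lemma meanDev_comp_le {α H : Type*} [MeasurableSpace α] [NormedAddCommGroup H]
    [NormedSpace ℝ H] [CompleteSpace H] {P : Measure α} {e : α → H} {m n : ℕ} (D : Fin m → α) (I : Fin n → Fin m) :
    meanDev P e (D ∘ I) ≤ meanDev (unif m) (e ∘ D) I + meanDev P e D := by
  simp only [meanDev, integral_unif, Function.comp_apply]
  exact norm_sub_le_norm_sub_add_norm_sub _ _ _

lemma abs_meanDev_sq_le {α H : Type*} [MeasurableSpace α] [NormedAddCommGroup H]
    [NormedSpace ℝ H] {P : Measure α} [IsProbabilityMeasure P] {e : α → H} {m : ℕ}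
    (he : ∀ z, ‖e z‖ ≤ 1) (s : Fin m → α) : |meanDev P e s ^ 2| ≤ 2 ^ 2 := by
  rw [abs_pow]
  gcongr
  exact abs_meanDev_le he s

section TwoStageDeviation

variable {α : Type*} [MeasurableSpace α] [Countable α] [MeasurableSingletonClass α]
  {P : Measure α} [IsProbabilityMeasure P] {H : Type*} [NormedAddCommGroup H]
  [InnerProductSpace ℝ H] [CompleteSpace H] {e : α → H} {m n : ℕ}

/-- Chebyshev after the triangle inequality between the two stages. The weights `√n` and `√m` in
Cauchy–Schwarz match the standard deviations, so the constant in front of `(1/√n + 1/√m) ^ 2` is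
exactly `1`. -/
lemma twoStage_real_le_meanDev_le (he : ∀ z, ‖e z‖ ≤ 1) (hm : 0 < m) (hn : 0 < n) {T : ℝ}
    (hT : 0 < T) :
    (twoStage P m n).real {x | T ≤ meanDev P e (x.1 ∘ x.2)} ≤ (1 / √n + 1 / √m) ^ 2 / T ^ 2 := by
  have := isProbabilityMeasure_unif hm
  have hm' : 0 < √(m : ℝ) := Real.sqrt_pos.2 (by exact_mod_cast hm)
  have hn' : 0 < √(n : ℝ) := Real.sqrt_pos.2 (by exact_mod_cast hn)
  have hm2 : √(m : ℝ) ^ 2 = m := Real.sq_sqrt (Nat.cast_nonneg m)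
  have hn2 : √(n : ℝ) ^ 2 = n := Real.sq_sqrt (Nat.cast_nonneg n)
  set c : ℝ := (1 / √n + 1 / √m) / T ^ 2 with hc
  have hc0 : 0 < c := by positivity
  have hcs : ∀ f g : ℝ, 0 ≤ f → 0 ≤ g → T ≤ f + g → 1 ≤ c * (√n * f ^ 2 + √m * g ^ 2) := by
    intro f g hf hg h
    have h1 : (f + g) ^ 2 ≤ (1 / √n + 1 / √m) * (√n * f ^ 2 + √m * g ^ 2) := by
      have h2 : (1 / √n + 1 / √m) * (√n * f ^ 2 + √m * g ^ 2) - (f + g) ^ 2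
          = (√n * f - √m * g) ^ 2 / (√n * √m) := by
        field_simp
        ring
      have h3 : 0 ≤ (√n * f - √m * g) ^ 2 / (√n * √m) := by positivity
      linarith
    have h4 : T ^ 2 ≤ (f + g) ^ 2 := by gcongr
    rw [hc, div_mul_eq_mul_div, one_le_div (by positivity)]
    exact h4.trans h1
  rw [twoStage_real hm]
  have hstep : ∀ D : Fin m → α,
      (iidMeasure (unif m) n).real {I | (D, I) ∈ {x | T ≤ meanDev P e (x.1 ∘ x.2)}}
        ≤ c * (1 / √n + √m * meanDev P e D ^ 2) := fun D => by
    have hi : Integrable (fun I => meanDev (unif m) (e ∘ D) I ^ 2) (iidMeasure (unif m) n) :=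
      integrable_of_bdd (abs_meanDev_sq_le fun z => he _)
    rw [real_eq_integral_indicator]
    calc _ ≤ ∫ I, c * (√n * meanDev (unif m) (e ∘ D) I ^ 2 + √m * meanDev P e D ^ 2)
            ∂iidMeasure (unif m) n := by
          refine integral_mono (integrable_of_bdd (abs_indicator_one_le _))
            (((hi.const_mul _).add (integrable_const _)).const_mul _) fun I => ?_
          change Set.indicator _ _ I ≤ _
          refine Set.indicator_apply_le' (fun hI => ?_) fun _ => by positivity
          exact hcs _ _ (norm_nonneg _) (norm_nonneg _) (le_trans hI (meanDev_comp_le D I))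
      _ = c * (√n * ∫ I, meanDev (unif m) (e ∘ D) I ^ 2 ∂iidMeasure (unif m) n
            + √m * meanDev P e D ^ 2) := by
          rw [integral_const_mul, integral_add (hi.const_mul _) (integrable_const _),
            integral_const_mul]
          simp
      _ ≤ c * (√n * (1 / n) + √m * meanDev P e D ^ 2) := by
          gcongr
          exact integral_iid_meanDev_sq_le (fun z => he _) hn
      _ = _ := by
          congr 2
          field_simp
          exact hn2
  have hi : Integrable (fun D => meanDev P e D ^ 2) (iidMeasure P m) :=
    integrable_of_bdd (abs_meanDev_sq_le he)
  calc _ ≤ ∫ D, c * (1 / √n + √m * meanDev P e D ^ 2) ∂iidMeasure P m :=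
        integral_mono (integrable_of_bdd fun D => abs_measureReal_le_one _)
          (((integrable_const _).add (hi.const_mul _)).const_mul _) hstep
    _ = c * (1 / √n + √m * ∫ D, meanDev P e D ^ 2 ∂iidMeasure P m) := by
        rw [integral_const_mul, integral_add (integrable_const _) (hi.const_mul _),
          integral_const_mul]
        simp
    _ ≤ c * (1 / √n + √m * (1 / m)) := by
        gcongr
        exact integral_iid_meanDev_sq_le he hm
    _ = c * (1 / √n + 1 / √m) := by
        congr 2
        field_simp
        exact hm2
    _ = _ := by
        rw [hc]
        ring

lemma twoStage_real_le_meanDev_le_exp (he : ∀ z, ‖e z‖ ≤ 1) (hm : 0 < m) (hn : 0 < n) {x : ℝ}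
    (hx : 0 ≤ x) :
    (twoStage P m n).real {y | (1 + x) * (1 / √n + 1 / √m) ≤ meanDev P e (y.1 ∘ y.2)}
      ≤ 2 * Real.exp (-(x ^ 2 / 2)) := by
  have := isProbabilityMeasure_unif hm
  rw [twoStage_real hm]
  set F : Set (Fin m → α) := {D | (1 + x) / √m ≤ meanDev P e D} with hF
  have hstep : ∀ D : Fin m → α, (iidMeasure (unif m) n).real
      {I | (D, I) ∈ {y | (1 + x) * (1 / √n + 1 / √m) ≤ meanDev P e (y.1 ∘ y.2)}}
        ≤ Real.exp (-(x ^ 2 / 2)) + F.indicator (fun _ => 1) D := fun D => by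
    by_cases hD : D ∈ F
    · rw [Set.indicator_of_mem hD]
      have := Real.exp_pos (-(x ^ 2 / 2))
      exact measureReal_le_one.trans (by linarith)
    · rw [Set.indicator_of_notMem hD, add_zero]
      refine le_trans (measureReal_mono fun I hI => ?_)
        (real_iid_le_meanDev_le_exp (P := unif m) (e := e ∘ D) (fun z => he _) hn hx)
      have h1 : (1 + x) * (1 / √n + 1 / √m) ≤ meanDev P e (D ∘ I) := hI
      have h2 := meanDev_comp_le (P := P) (e := e) D I
      have h3 : meanDev P e D < (1 + x) / √m := not_le.1 hD
      change (1 + x) / √n ≤ _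
      have h4 : (1 + x) * (1 / √n + 1 / √m) = (1 + x) / √n + (1 + x) / √m := by ring
      linarith
  have hi : Integrable (F.indicator fun _ => (1 : ℝ)) (iidMeasure P m) :=
    integrable_of_bdd (abs_indicator_one_le _)
  calc _ ≤ ∫ D, (Real.exp (-(x ^ 2 / 2)) + F.indicator (fun _ => 1) D) ∂iidMeasure P m :=
        integral_mono (integrable_of_bdd fun D => abs_measureReal_le_one _)
          ((integrable_const _).add hi) hstep
    _ = Real.exp (-(x ^ 2 / 2)) + (iidMeasure P m).real F := by
        rw [integral_add (integrable_const _) hi, real_eq_integral_indicator]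
        simp
    _ ≤ _ := by linarith [real_iid_le_meanDev_le_exp (P := P) he hm hx]

end TwoStageDeviation

/-! ### Empirical distributions as means of unit vectors in `ℓ²` -/

section SquareSummable

open Classical in
/-- The canonical orthonormal family of `ℓ²(α)`. -/
noncomputable def unitVec {α : Type*} (y : α) : lp (fun _ : α => ℝ) 2 := lp.single 2 y 1

lemma inner_unitVec {α : Type*} (w : lp (fun _ : α => ℝ) 2) (y : α) :
    inner ℝ w (unitVec y) = w y := by
  classical
  rw [unitVec, lp.inner_single_right]
  simp

open Classical in
lemma unitVec_apply {α : Type*} (y z : α) : unitVec y z = if z = y then 1 else 0 := by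
  rw [unitVec, lp.single_apply, Pi.single_apply]

lemma norm_unitVec {α : Type*} (y : α) : ‖unitVec y‖ = 1 := by
  have h : ‖unitVec y‖ ^ 2 = 1 := by
    rw [← real_inner_self_eq_norm_sq, inner_unitVec, unitVec_apply, if_pos rfl]
  exact (pow_eq_one_iff_of_nonneg (norm_nonneg _) two_ne_zero).1 h

lemma inner_mean_unitVec {α : Type*} {n : ℕ} (s : Fin n → α) (y : α) :
    inner ℝ ((n : ℝ)⁻¹ • ∑ i, unitVec (s i)) (unitVec y) = (n : ℝ)⁻¹ * letterCount s y := by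
  rw [inner_smul_left, sum_inner, letterCount, weightedCount]
  push_cast
  simp only [inner_unitVec, unitVec_apply, conj_trivial]
  congr 1
  refine Finset.sum_congr rfl fun i _ => ?_
  by_cases h : s i = y
  · simp [h]
  · simp [h, Ne.symm h]

variable {α : Type*} [MeasurableSpace α] [Countable α] [MeasurableSingletonClass α]
  {P : Measure α} [IsProbabilityMeasure P] {n : ℕ}

lemma inner_integral_unitVec (y : α) :
    inner ℝ (∫ z, unitVec z ∂P) (unitVec y) = P.real {y} := by
  rw [real_inner_comm, ← integral_inner (integrable_of_norm_le_one fun z => (norm_unitVec z).le),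
    real_eq_integral_indicator]
  congr 1
  ext z
  rw [inner_unitVec, unitVec_apply]
  by_cases h : z = y <;> simp [h]

/-- If a letter that is less likely than `a` by `t` is as frequent as `a`, then the empirical
distribution is far from the law in `ℓ²`. -/
lemma le_meanDev_unitVec {s : Fin n → α} {a y : α} {t : ℝ} (ht : P.real {y} + t ≤ P.real {a})
    (h : letterCount s a ≤ letterCount s y) : t / √2 ≤ meanDev P unitVec s := by
  rw [div_le_iff₀ (by positivity), meanDev]
  set w := (n : ℝ)⁻¹ • ∑ i, unitVec (s i) - ∫ z, unitVec z ∂P with hw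
  -- The deviation is tested against a vector of norm at most `√2`, on which a wrong order of counts
  -- yields at least `t`.
  have h1 : inner ℝ w (unitVec y - unitVec a) = (n : ℝ)⁻¹ * letterCount s y - P.real {y}
      - ((n : ℝ)⁻¹ * letterCount s a - P.real {a}) := by
    rw [inner_sub_right, hw, inner_sub_left, inner_sub_left, inner_mean_unitVec,
      inner_mean_unitVec, inner_integral_unitVec, inner_integral_unitVec]
  have h2 : (n : ℝ)⁻¹ * letterCount s a ≤ (n : ℝ)⁻¹ * letterCount s y := by gcongr
  have h3 : ‖unitVec y - unitVec a‖ ≤ √2 := by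
    refine Real.le_sqrt_of_sq_le ?_
    rw [norm_sub_sq_real, norm_unitVec, norm_unitVec, inner_unitVec, unitVec_apply]
    split_ifs <;> norm_num
  calc t ≤ inner ℝ w (unitVec y - unitVec a) := by linarith
    _ ≤ ‖w‖ * ‖unitVec y - unitVec a‖ := real_inner_le_norm _ _
    _ ≤ ‖w‖ * √2 := by gcongr

end SquareSummable

/-! ### Combination of the regimes of `L` -/

section Majority

variable {α : Type*} [MeasurableSpace α] [Countable α] [MeasurableSingletonClass α]
  {P : Measure α} [IsProbabilityMeasure P] {m n : ℕ}

lemma one_sub_real_meanDev_le (hm : 0 < m) {a : α} {B : Set α} {t : ℝ}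
    (hB : ∀ y ∈ B, P.real {y} + t ≤ P.real {a}) :
    1 - (twoStage P m n).real {x | t / √2 ≤ meanDev P unitVec (x.1 ∘ x.2)}
      ≤ (twoStage P m n).real
        {x | ∀ y ∈ B, letterCount (x.1 ∘ x.2) y < letterCount (x.1 ∘ x.2) a} := by
  have := isProbabilityMeasure_unif hm
  rw [← probReal_compl_eq_one_sub (Set.to_countable _).measurableSet]
  refine measureReal_mono fun x hx y hy => ?_
  by_contra! h
  exact hx (le_meanDev_unitVec (hB y hy) h)

/-- Calibrates the tie-breaking bound to the target `t² / (64 v)`. Capping the mass set aside at `p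
/ 4` leaves `3 p / 4` for the exchange argument. -/
lemma sq_div_le_mul_div {p t v ρ : ℝ} (hp : 0 < p) (ht : 0 < t) (htp : t < p) (hρ : 0 < ρ)
    (hv : ρ ≤ v) (h : t ^ 2 ≤ 30 * p * v) :
    t ^ 2 / (64 * v) ≤ (p - min t (p / 4)) * (min t (p / 4) / (min t (p / 4) + 4 * ρ)) := by
  have hv0 : 0 < v := hρ.trans_le hv
  set τ := min t (p / 4) with hτ
  have hτ0 : 0 < τ := lt_min ht (by positivity)
  have hτp : τ ≤ p / 4 := min_le_right _ _
  have h1 : 3 / 4 * p * (τ / (τ + 4 * v)) ≤ (p - τ) * (τ / (τ + 4 * ρ)) := by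
    gcongr <;> linarith
  refine le_trans ?_ h1
  rw [← mul_div_assoc, div_le_div_iff₀ (by positivity) (by positivity)]
  rcases le_total t (p / 4) with h4 | h4
  · rw [min_eq_left h4] at hτ
    rw [hτ]
    have e1 : t * v ≤ p / 4 * v := by gcongr
    have e2 : t * (t ^ 2 + 4 * (t * v)) ≤ t * (48 * (p * v)) := by
      gcongr
      have : 0 < p * v := by positivity
      linarith
    linarith
  · rw [min_eq_right h4] at hτ
    rw [hτ]
    have e1 : t ^ 2 * (p + 16 * v) ≤ 48 * p ^ 2 * v := by
      rcases le_total p (32 * v) with h5 | h5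
      · calc t ^ 2 * (p + 16 * v) ≤ p ^ 2 * (32 * v + 16 * v) := by gcongr
          _ = _ := by ring
      · calc t ^ 2 * (p + 16 * v) ≤ (30 * p * v) * (p + p / 2) := by
              gcongr
              linarith
          _ = 45 * (p ^ 2 * v) := by ring
          _ ≤ 48 * (p ^ 2 * v) := by
              gcongr
              norm_num
          _ = _ := by ring
    linarith

/-- In a two-stage sample, `a` is more frequent than all letters that are less likely by
`8 √L (1 / √n + 1 / √m)`, with probability at least `1 - exp (-L)`. -/
lemma one_sub_exp_le_twoStage_real (hm : 0 < m) (hn : 0 < n) {L : ℝ} (hL : 0 < L) {a : α}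
    {B : Set α} (hB : ∀ y ∈ B, P.real {y} + 8 * √L * (1 / √n + 1 / √m) < P.real {a}) :
    1 - Real.exp (-L) ≤ (twoStage P m n).real
      {x | ∀ y ∈ B, letterCount (x.1 ∘ x.2) y < letterCount (x.1 ∘ x.2) a} := by
  have := isProbabilityMeasure_unif hm
  have hm' : 0 < √(m : ℝ) := Real.sqrt_pos.2 (by exact_mod_cast hm)
  have hn' : 0 < √(n : ℝ) := Real.sqrt_pos.2 (by exact_mod_cast hn)
  have hL' : 0 < √L := Real.sqrt_pos.2 hL
  have hL2 : √L ^ 2 = L := Real.sq_sqrt hL.le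
  have h22 : √(2 : ℝ) ^ 2 = 2 := Real.sq_sqrt zero_le_two
  set r : ℝ := 1 / √n + 1 / √m with hr
  have hr0 : 0 < r := by positivity
  set t := 8 * √L * r with ht
  have ht0 : 0 < t := by positivity
  have ht2 : t ^ 2 = 64 * L * r ^ 2 := by rw [ht, mul_pow, mul_pow, hL2]; norm_num
  have hadd : 1 - L ≤ Real.exp (-L) := by linarith [Real.add_one_le_exp (-L)]
  have hdev := one_sub_real_meanDev_le (P := P) (n := n) hm fun y hy => (hB y hy).le
  have hunit : ∀ z : α, ‖unitVec z‖ ≤ 1 := fun z => (norm_unitVec z).le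
  -- Here `w = 4 √(2 L)` is at least `5`, so `(w - 1)² / 2 ≥ 10 L ≥ L + 1`, and the extra `exp (-1)`
  -- absorbs the factor `2` of the two-stage tail.
  rcases le_or_gt (9 / 10) L with h1 | h1
  · set w := 4 * √2 * √L with hw
    have hw2 : w ^ 2 = 32 * L := by rw [hw, mul_pow, mul_pow, hL2, h22]; norm_num
    have hw5 : 5 ≤ w := by
      refine le_of_sq_le_sq ?_ (by positivity)
      linarith
    have htw : t / √2 = (1 + (w - 1)) * r := by
      rw [div_eq_iff (by positivity), ht, hw]
      linear_combination (-4 * √L * r) * h22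
    have h2 := twoStage_real_le_meanDev_le_exp (P := P) hunit hm hn (by linarith : 0 ≤ w - 1)
    rw [← hr, ← htw] at h2
    have h3 : L + 1 ≤ (w - 1) ^ 2 / 2 := by
      have : (4 / 5 * w) ^ 2 ≤ (w - 1) ^ 2 := by
        gcongr
        linarith
      rw [mul_pow, hw2] at this
      linarith
    have h4 : 2 * Real.exp (-((w - 1) ^ 2 / 2)) ≤ Real.exp (-L) :=
      calc 2 * Real.exp (-((w - 1) ^ 2 / 2)) ≤ Real.exp 1 * Real.exp (-(L + 1)) := by
            gcongr
            linarith [Real.add_one_le_exp (1 : ℝ)]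
        _ = _ := by
            rw [← Real.exp_add]
            congr 1
            ring
    linarith
  -- The failure probability is at most `1 / (32 L)`, which is below `1 - L ≤ exp (-L)` throughout
  -- `[1/30, 29/30]`.
  rcases le_or_gt (1 / 30) L with h2 | h2
  · have h3 := twoStage_real_le_meanDev_le (P := P) hunit hm hn
      (by positivity : 0 < t / √2)
    rw [← hr, div_pow, h22, ht2] at h3
    have h4 : r ^ 2 / (64 * L * r ^ 2 / 2) ≤ 1 - L := by
      have e : r ^ 2 / (64 * L * r ^ 2 / 2) = 1 / (32 * L) := by
        field_simp
        norm_num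
      rw [e, div_le_iff₀ (by positivity)]
      nlinarith [mul_nonneg (sub_nonneg.2 h2) (by linarith : 0 ≤ 29 / 30 - L)]
    linarith
  have hρ0 : 0 < 1 / (n : ℝ) + 1 / m := by
    have : (0 : ℝ) < n := by exact_mod_cast hn
    positivity
  have hρ : 1 / (n : ℝ) + 1 / m ≤ r ^ 2 := by
    have e1 : 1 / (n : ℝ) = (1 / √n) ^ 2 := by rw [div_pow, Real.sq_sqrt (Nat.cast_nonneg n), one_pow]
    have e2 : 1 / (m : ℝ) = (1 / √m) ^ 2 := by rw [div_pow, Real.sq_sqrt (Nat.cast_nonneg m), one_pow]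
    have e3 : 0 ≤ 2 * (1 / √(n : ℝ)) * (1 / √m) := by positivity
    rw [e1, e2, hr, add_sq]
    linarith
  have hLt : t ^ 2 / (64 * r ^ 2) = L := by
    rw [ht2]
    field_simp
  -- For the remaining small `L`, the weaker target `L ≥ 1 - exp (-L)` suffices.
  suffices h : t ^ 2 / (64 * r ^ 2) ≤ (twoStage P m n).real
      {x | ∀ y ∈ B, letterCount (x.1 ∘ x.2) y < letterCount (x.1 ∘ x.2) a} by linarith
  rcases le_or_gt (P.real {a}) t with h3 | htp
  · have hU : {x : (Fin m → α) × (Fin n → Fin m) |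
        ∀ y ∈ B, letterCount (x.1 ∘ x.2) y < letterCount (x.1 ∘ x.2) a} = Set.univ :=
      Set.eq_univ_of_forall fun x y hy => by
        linarith [hB y hy, measureReal_nonneg (μ := P) (s := {y})]
    rw [hU, probReal_univ]
    linarith
  rcases le_or_gt (t ^ 2) (30 * P.real {a} * r ^ 2) with h4 | h4
  · have hp0 : 0 < P.real {a} := ht0.trans htp
    refine (sq_div_le_mul_div hp0 ht0 htp hρ0 hρ h4).trans
      (le_twoStage_real_letterCount_lt hm hn (lt_min ht0 (by positivity))
        (by linarith [min_le_right t (P.real {a} / 4)]) fun y hy => ?_)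
    linarith [hB y hy, min_le_left t (P.real {a} / 4)]
  · refine sq_div_le_twoStage_real_letterCount_lt hm hn hρ ht0 htp
      (fun y hy => by linarith [hB y hy]) h4 ?_
    rw [ht2]
    gcongr
    linarith

end Majority

/-! ### The law of a two-stage sample -/

lemma empiricalProb_eq {α : Type*} {k : ℕ} (s : Fin k → α) (y : α) :
    empiricalProb s y = letterCount s y / k := by
  classical
  rw [empiricalProb, letterCount, weightedCount]
  push_cast
  rw [one_div_mul_eq_div]
  congr 1
  refine Finset.sum_congr rfl fun i _ => ?_
  by_cases h : s i = y
  · rw [if_pos h.symm, if_pos h]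
  · rw [if_neg (Ne.symm h), if_neg h]

section Law

variable {Ω Y : Type*} [MeasurableSpace Ω] [Countable Y] [MeasurableSpace Y]
  [MeasurableSingletonClass Y] {μ : Measure Ω} [IsProbabilityMeasure μ]
  {Phuman : Measure Y} [IsProbabilityMeasure Phuman] {m n : ℕ}
  {D : Fin m → Ω → Y} {S : Fin n → Ω → Y}

lemma IsTwoStageSample.map_eq (hDS : IsTwoStageSample μ Phuman D S) (hm : 0 < m) :
    μ.map (fun ω => ((fun i => D i ω), fun j => S j ω))
      = (twoStage Phuman m n).map fun x => (x.1, x.1 ∘ x.2) := by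
  have := isProbabilityMeasure_unif hm
  have hD : Measurable fun ω i => D i ω := measurable_pi_iff.2 hDS.measurable_dataset
  have hS : Measurable fun ω j => S j ω := measurable_pi_iff.2 hDS.measurable_refs
  have hlaw : μ.map (fun ω i => D i ω) = iidMeasure Phuman m := by
    rw [(iIndepFun_iff_map_fun_eq_pi_map
      fun i => (hDS.measurable_dataset i).aemeasurable).1 hDS.indep_dataset]
    simp only [hDS.law_dataset, iidMeasure]
  -- Both laws live on a countable space, so point masses decide. Given `D = d`, the indices with `d
  -- (I j) = s j` for all `j` have as probability the product of the empirical probabilities of the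
  -- `s j`.
  refine Measure.ext_iff_singleton.2 fun ⟨d, s⟩ => ?_
  have hf : Measurable fun x : (Fin m → Y) × (Fin n → Fin m) => (x.1, x.1 ∘ x.2) :=
    Measurable.of_discrete
  rw [← measureReal_eq_measureReal_iff, map_measureReal_apply (hD.prodMk hS) (measurableSet_singleton _),
    map_measureReal_apply hf (measurableSet_singleton _)]
  have e1 : (fun ω => ((fun i => D i ω), fun j => S j ω)) ⁻¹' {(d, s)}
      = {ω | (∀ i, D i ω = d i) ∧ ∀ j, S j ω = s j} := by
    ext ω
    simp [funext_iff]
  have e2 : (fun x : (Fin m → Y) × (Fin n → Fin m) => (x.1, x.1 ∘ x.2)) ⁻¹' {(d, s)}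
      = {d} ×ˢ Set.univ.pi fun j => {i | d i = s j} := by
    ext ⟨d', I⟩
    simp only [Set.mem_preimage, Set.mem_singleton_iff, Prod.mk.injEq, Set.mem_prod, Set.mem_pi,
      Set.mem_univ, true_implies, Set.mem_ofPred_eq]
    refine and_congr_right fun h => ?_
    rw [h, funext_iff]
    rfl
  have e3 : {ω | ∀ i, D i ω = d i} = (fun ω i => D i ω) ⁻¹' {d} := by
    ext ω
    simp [funext_iff]
  rw [e1, e2, hDS.cond_law_refs, measureReal_prod_prod, e3,
    ← map_measureReal_apply hD (measurableSet_singleton _), hlaw]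
  congr 1
  rw [measureReal_def, Measure.pi_pi, ENNReal.toReal_prod]
  refine Finset.prod_congr rfl fun j _ => ?_
  rw [empiricalProb_eq, ← unif_real_letter]
  rfl

lemma IsTwoStageSample.real_eq (hDS : IsTwoStageSample μ Phuman D S) (hm : 0 < m)
    (A : Set ((Fin m → Y) × (Fin n → Y))) :
    μ.real {ω | ((fun i => D i ω), fun j => S j ω) ∈ A}
      = (twoStage Phuman m n).real {x | (x.1, x.1 ∘ x.2) ∈ A} := by
  have hA : MeasurableSet A := (Set.to_countable A).measurableSet
  have hD : Measurable fun ω i => D i ω := measurable_pi_iff.2 hDS.measurable_dataset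
  have hS : Measurable fun ω j => S j ω := measurable_pi_iff.2 hDS.measurable_refs
  have h := congrArg (fun ν => ν.real A) (hDS.map_eq hm)
  beta_reduce at h
  rwa [map_measureReal_apply (hD.prodMk hS) hA, map_measureReal_apply Measurable.of_discrete hA] at h

end Law

/-- Letters outside the sample have count zero, so maximising over the sample is maximising over all
letters. -/
lemma letterCount_le_of_isArgmaxOn {α : Type*} {n : ℕ} (hn : 0 < n) {s : Fin n → α} {y : α}
    (h : IsArgmaxOn (empiricalProb s) (Set.range s) y) (a : α) :
    letterCount s a ≤ letterCount s y := by
  by_cases ha : a ∈ Set.range s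
  · have h1 := h.2 a ha
    rw [empiricalProb_eq, empiricalProb_eq, div_le_div_iff_of_pos_right (by exact_mod_cast hn)] at h1
    exact_mod_cast h1
  · have : letterCount s a = 0 := Finset.sum_eq_zero fun i _ => if_neg fun hi => ha ⟨i, hi⟩
    omega

theorem theorem4 {Ω Y : Type*} [MeasurableSpace Ω]
    [Countable Y] [MeasurableSpace Y] [MeasurableSingletonClass Y]
    (μ : Measure Ω) [IsProbabilityMeasure μ]
    (Phuman : Measure Y) [IsProbabilityMeasure Phuman]
    {m n : ℕ} (hm : 0 < m) (hn : 0 < n)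
    (D : Fin m → Ω → Y) (S : Fin n → Ω → Y)
    (hDS : IsTwoStageSample μ Phuman D S)
    (ystar : Y) (hystar : IsArgmaxOn (fun y => Phuman.real {y}) Set.univ ystar)
    (yhat : Ω → Y) (hyhat_meas : Measurable yhat)
    (hyhat : ∀ᵐ ω ∂μ,
      IsArgmaxOn (empiricalProb (fun j => S j ω)) (Set.range (fun j => S j ω)) (yhat ω))
    (δ : ℝ) (hδ0 : 0 < δ) (hδ1 : δ < 1) :
    1 - δ ≤ μ.real {ω | mapRegret Phuman ystar (yhat ω) ≤
      8 * √(1 / (n : ℝ) * Real.log (1 / δ)) + 8 * √(1 / (m : ℝ) * Real.log (1 / δ))} := by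
  set L := Real.log (1 / δ) with hL
  have hL0 : 0 < L := Real.log_pos (by rw [lt_div_iff₀ hδ0]; linarith)
  have hexp : Real.exp (-L) = δ := by
    rw [hL, one_div, Real.log_inv, neg_neg, Real.exp_log hδ0]
  have hbound : 8 * √(1 / (n : ℝ) * L) + 8 * √(1 / (m : ℝ) * L)
      = 8 * √L * (1 / √n + 1 / √m) := by
    rw [Real.sqrt_mul (by positivity), Real.sqrt_mul (by positivity), Real.sqrt_div zero_le_one,
      Real.sqrt_div zero_le_one, Real.sqrt_one]
    ring
  set B : Set Y := {y | Phuman.real {y} + 8 * √L * (1 / √n + 1 / √m) < Phuman.real {ystar}} with hB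
  have h1 := one_sub_exp_le_twoStage_real (P := Phuman) hm hn hL0 (a := ystar) (B := B)
    fun y hy => hy
  have h2 := hDS.real_eq hm {x | ∀ y ∈ B, letterCount x.2 y < letterCount x.2 ystar}
  rw [hexp] at h1
  refine h1.trans (le_of_eq_of_le h2.symm (ENNReal.toReal_mono (measure_ne_top _ _)
    (measure_mono_ae ?_)))
  filter_upwards [hyhat] with ω hω hlt
  rw [hbound]
  -- A regret above the bound puts `yhat ω` in `B`, where its count is strictly below that of
  -- `ystar`; however ties are broken, a maximiser cannot do that.
  by_contra hfail
  have hmem : yhat ω ∈ B := by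
    have h3 : ¬ Phuman.real {ystar} - Phuman.real {yhat ω}
      ≤ 8 * √L * (1 / √n + 1 / √m) := hfail
    change (_ : ℝ) + _ < _
    linarith
  exact (hlt _ hmem).not_ge (letterCount_le_of_isArgmaxOn hn hω ystar)
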